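/- **Model.** Let $G=(V,E)$ be a finite connected graph of quantum repeaters; time is divided into slots $t=0,1,2,\dots$ of duration $\Delta>0$. In each slot each of the $S(e)$ modes of a link $e$ succeeds with probability $p_0(e)=e^{-\alpha L(e)}$, and $N_t(e)=\min\{\#\text{successful modes},m_{\max}(e)\}$ new pairs of fidelity $F_0(e)\in[1/4,1]$ are retained; $\mathcal H_t=\{e:N_t(e)\ge 1\}$. Besides these, the pairs stored in the $m_{\max}(e)$ memory cells of each link are available. Knowing $N_t$ and the stored pairs with their ages and fidelities, the controller selects an action $a(t)$: at most $R$ activations of simple paths for requested source–destination pairs (flows) $(s,d)$, $s\neq d$, with the pair to be swapped on every edge; optional BBPSSW purifications on links (with a fixed bit-flip or Werner noise model; the success probability and output fidelity are the BBPSSW ones for that model); and the pairs to be kept in memory. No pair is used twice, and at most $N_t(e)$ paths are activated on $e$. A stationary policy is a measurable time-independent rule giving $a(t)$ from the observation and a uniform random seed. The Bell-state measurement of an activation at each intermediate repeater succeeds with probability $q\in(0,1]$. The Werner parameter of a pair of fidelity $F$ is $(4F-1)/3$; an end-to-end pair has as parameter the product of the parameters along the path, and storage for one slot multiplies the parameter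 by $e^{-\Delta/T_2}$. Stored pairs are lost after $T_{\mathrm{mem}}\ge1$ slots or when their fidelity falls below the threshold $F_{\min}\in(1/4,1)$. The mode outcomes, controller seeds, purification and measurement randomness are independent, independent across slots with the same law, and independent of the initially stored pairs. Let $Y_t\in\{0,1\}$ indicate that in slot $t$ some path $\pi\subseteq\mathcal H_t$ selected by $a(t)$ for a fixed flow $(s,d)$ has a pair on each edge after purification, succeeds in all its swaps, and has end-to-end fidelity at least $F_{\min}$. The Fidelity-Age of the flow is $A(u)=\Delta A_{\lfloor u/\Delta\rfloor}+(u-\Delta\lfloor u/\Delta\rfloor)$ for real times $u\ge0$, where $A_t=t-\max\{r\le t:Y_r=1\}$, and $A_t=t$ if there is no such $r$; that is, it is reset to $0$ at each delivery and grows at unit rate in between, also within slots. **Theorem (FA renewal identity).** Fix a slot duration $\Delta>0$, a stationary policy and a flow. Assume that the state process $Z_t=(N_t,\ \text{stored pairs with their ages and fidelities},\ a(t))$ is stationary and ergodic, that $0<\Pr\{Y_t=1\}<1$, and that, under the conditional law given $Y_t=1$, the inter-delivery time $\tau=\inf\{\ell\ge1:Y_{t+\ell}=1\}$ (in slots) has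 finite first and second moments. Then almost surely the long-run time-average Fidelity-Age exists and $$\lim_{T\to\infty}\frac1T\int_0^T A(u)\,du=\Delta\,\frac{\mathbb E[\tau^2\mid Y_t=1]}{2\,\mathbb E[\tau\mid Y_t=1]}.$$ In particular, if $\tau$ given $Y_t=1$ is geometric on $\{1,2,\dots\}$ with parameter $p\in(0,1]$, this limit is $\Delta(2-p)/(2p)$. -/

import Mathlib

open MeasureTheory ProbabilityTheory Filter Topology
open scoped ENNReal unitInterval

noncomputable section

namespace FidelityAge

/-- The measurable structure of `Option α` as the disjoint union of `{none}` and `α`: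
a set is measurable iff its trace on `α` is. -/
instance instMeasurableSpaceOption {α : Type*} [MeasurableSpace α] : MeasurableSpace (Option α) :=
  MeasurableSpace.map some inferInstance

/-! ### Purification -/

/-- The fixed noise model used for BBPSSW purification. -/
inductive NoiseModel
  | bitFlip
  | werner

/-- Success probability of one BBPSSW round on two pairs of fidelities `F₁`, `F₂`. -/
def NoiseModel.purifyProb : NoiseModel → ℝ → ℝ → ℝ
  | .bitFlip, F₁, F₂ => F₁ * F₂ + (1 - F₁) * (1 - F₂)
  | .werner, F₁, F₂ =>
      F₁ * F₂ + F₁ * (1 - F₂) / 3 + (1 - F₁) * F₂ / 3 + 5 * (1 - F₁) * (1 - F₂) / 9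

/-- Fidelity of the surviving pair after a successful BBPSSW round. -/
def NoiseModel.purifyFidelity : NoiseModel → ℝ → ℝ → ℝ
  | .bitFlip, F₁, F₂ => F₁ * F₂ / NoiseModel.purifyProb .bitFlip F₁ F₂
  | .werner, F₁, F₂ =>
      (F₁ * F₂ + (1 - F₁) * (1 - F₂) / 9) / NoiseModel.purifyProb .werner F₁ F₂

/-! ### The repeater network -/

/-- Fixed physical and operational parameters of a slotted repeater network on the graph `G`. -/
structure Network {V : Type*} (G : SimpleGraph V) where
  connected : G.Connected
  /-- slot duration `Δ` -/
  slot : ℝ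
  slot_pos : 0 < slot
  /-- number `S(e)` of parallel modes of a link -/
  modes : G.edgeSet → ℕ
  /-- link length `L(e)` -/
  length : G.edgeSet → ℝ
  length_pos : ∀ e, 0 < length e
  /-- fibre loss coefficient `α` -/
  loss : ℝ
  loss_pos : 0 < loss
  /-- cap `m_max(e)` on the pairs retained per slot, and on the pairs kept in memory -/
  cap : G.edgeSet → ℕ
  /-- fidelity of a fresh link-level pair -/
  freshFidelity : G.edgeSet → ℝ
  freshFidelity_mem : ∀ e, freshFidelity e ∈ Set.Icc (1 / 4 : ℝ) 1
  /-- success probability `q` of a Bell-state measurement -/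
  swapProb : I
  swapProb_pos : 0 < swapProb
  noise : NoiseModel
  /-- coherence time `T₂` -/
  coherence : ℝ
  coherence_pos : 0 < coherence
  /-- memory lifetime `T_mem`, in slots -/
  memory : ℕ
  memory_pos : 1 ≤ memory
  /-- usability threshold `F_min` -/
  threshold : ℝ
  threshold_mem : threshold ∈ Set.Ioo (1 / 4 : ℝ) 1
  /-- attempt budget `R` -/
  budget : ℕ
  /-- the source--destination requests (flows) -/
  requests : Finset (V × V)
  requests_ne : ∀ f ∈ requests, f.1 ≠ f.2

variable {V : Type*} {G : SimpleGraph V}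

/-- Per-mode success probability `p₀(e) = exp (-α L(e))`. -/
def Network.linkProb (net : Network G) (e : G.edgeSet) : I :=
  ⟨Real.exp (-(net.loss * net.length e)), (Real.exp_pos _).le,
    Real.exp_le_one_iff.2 (neg_nonpos.2 (mul_pos net.loss_pos (net.length_pos e)).le)⟩

/-- Werner parameter `(4F - 1) / 3` of a pair of fidelity `F`. -/
def wernerParam (F : ℝ) : ℝ := (4 * F - 1) / 3

/-- Fidelity `(1 + 3 p) / 4` of a Werner pair of parameter `p`. -/
def wernerFidelity (p : ℝ) : ℝ := (1 + 3 * p) / 4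

/-- Storage for one slot multiplies the Werner parameter by `exp (-Δ / T₂)`. -/
def Network.decay (net : Network G) (F : ℝ) : ℝ :=
  wernerFidelity (wernerParam F * Real.exp (-(net.slot / net.coherence)))

/-- A stored pair is described by its age in slots and its current fidelity. -/
abbrev Pair : Type := ℕ × ℝ

/-- Stored pairs: every edge `e` has `m_max(e)` memory cells, each empty or holding one pair. -/
abbrev Network.Inventory (net : Network G) : Type _ :=
  ∀ e : G.edgeSet, Fin (net.cap e) → Option Pair

/-- The external multigraph of a slot: the number of newly retained pairs on every edge. -/
abbrev External (G : SimpleGraph V) : Type _ := G.edgeSet → ℕ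

/-- Names of the pairs that may be present on edge `e` within a slot: the contents of a memory
cell (`inl`), or one of the newly retained pairs (`inr`). -/
abbrev Network.PairName (net : Network G) (e : G.edgeSet) : Type :=
  Fin (net.cap e) ⊕ Fin (net.cap e)

/-- The pairs present on an edge after the external phase. -/
def Network.pool (net : Network G) (n : External G) (s : net.Inventory) (e : G.edgeSet) :
    net.PairName e → Option Pair
  | .inl i => s e i
  | .inr i => if (i : ℕ) < n e then some (0, net.freshFidelity e) else none

/-! ### Controller actions -/

/-- Activation of a simple path for a flow, with the pair to be swapped on every edge
(only the choices on the edges of the path matter). -/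
structure Network.Activation (net : Network G) where
  flow : V × V
  path : G.Path flow.1 flow.2
  pick : ∀ e : G.edgeSet, net.PairName e

/-- The edge `e` lies on the activated path. -/
def Network.Activation.Uses {net : Network G} (A : net.Activation) (e : G.edgeSet) : Prop :=
  (e : Sym2 V) ∈ (A.path : G.Walk A.flow.1 A.flow.2).edges

/-- An action: at most `R` path activations, optional purifications
(`purify e r = some r'`: pair `r` is purified at the cost of pair `r'`), and the pairs
that go to the memory cells at the end of the slot. -/
structure Network.Action (net : Network G) where
  activate : Fin net.budget → Option net.Activation
  purify : ∀ e : G.edgeSet, net.PairName e → Option (net.PairName e)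
  keep : ∀ e : G.edgeSet, Fin (net.cap e) → Option (net.PairName e)

instance Network.instMeasurableSpaceAction (net : Network G) : MeasurableSpace net.Action := ⊤

/-- Feasibility of an action, given the external multigraph and the stored pairs. -/
structure Network.Feasible (net : Network G) (n : External G) (s : net.Inventory)
    (a : net.Action) : Prop where
  /-- only requested flows are served -/
  flow_mem : ∀ j A, a.activate j = some A → A.flow ∈ net.requests
  /-- purification acts on two distinct existing pairs of the same link -/
  purify_ne : ∀ e r r', a.purify e r = some r' → r ≠ r'
  purify_left : ∀ e r r', a.purify e r = some r' → (net.pool n s e r).isSome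
  purify_right : ∀ e r r', a.purify e r = some r' → (net.pool n s e r').isSome
  /-- every pair takes part in at most one purification -/
  purify_once : ∀ e r r', a.purify e r = some r' → a.purify e r' = none
  purify_inj : ∀ e r₁ r₂ r', a.purify e r₁ = some r' → a.purify e r₂ = some r' → r₁ = r₂
  /-- swapped pairs exist and are not given up in a purification -/
  pick_isSome : ∀ j A, a.activate j = some A → ∀ e, A.Uses e →
    (net.pool n s e (A.pick e)).isSome
  pick_left : ∀ j A, a.activate j = some A → ∀ e, A.Uses e → ∀ r, a.purify e r ≠ some (A.pick e)
  /-- no pair is swapped on two paths -/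
  pick_inj : ∀ j₁ j₂ A₁ A₂, a.activate j₁ = some A₁ → a.activate j₂ = some A₂ → j₁ ≠ j₂ →
    ∀ e, A₁.Uses e → A₂.Uses e → A₁.pick e ≠ A₂.pick e
  /-- at most as many paths are activated on an edge as there are newly retained pairs on it -/
  multiplicity : ∀ e, {j | ∃ A, a.activate j = some A ∧ A.Uses e}.ncard ≤ n e
  /-- a pair is kept in at most one cell, and only if it was not swapped -/
  keep_inj : ∀ e i₁ i₂ r, a.keep e i₁ = some r → a.keep e i₂ = some r → i₁ = i₂
  keep_unused : ∀ e i r, a.keep e i = some r →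
    ∀ j A, a.activate j = some A → A.Uses e → A.pick e ≠ r

/-- A stationary nonanticipative (possibly randomized) policy: the action is a time-independent
function of the observed external successes, the stored pairs, and a uniform random seed. -/
structure Network.Policy (net : Network G) where
  act : External G × net.Inventory × I → net.Action
  measurable_act : Measurable act
  feasible : ∀ n s u, net.Feasible n s (act (n, s, u))

/-! ### Randomness of one slot -/

/-- Success indicators of all modes of all edges. -/
abbrev Network.ModeOutcomes (net : Network G) : Type _ :=
  ∀ e : G.edgeSet, Fin (net.modes e) → Bool

/-- Internal randomness: uniform variables that decide the purification rounds, and the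
outcome of the Bell-state measurement of every activation at every repeater. -/
abbrev Network.Internal (net : Network G) : Type _ :=
  (∀ e : G.edgeSet, net.PairName e → I) × (Fin net.budget → V → Bool)

/-- All randomness of one slot: mode outcomes, seed of the controller, internal randomness. -/
abbrev Network.SlotNoise (net : Network G) : Type _ :=
  (net.ModeOutcomes × I) × net.Internal

/-- All random variables of a slot are independent; modes succeed with probability `p₀(e)`,
Bell-state measurements with probability `q`. -/
def Network.slotLaw [Fintype V] [DecidableEq V] [DecidableRel G.Adj] (net : Network G) :
    Measure net.SlotNoise :=
  ((Measure.pi fun e => Measure.pi fun _ => bernoulliMeasure true false (net.linkProb e)).prod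
      volume).prod
    ((Measure.pi fun _ => Measure.pi fun _ => volume).prod
      (Measure.pi fun _ => Measure.pi fun _ => bernoulliMeasure true false net.swapProb))

/-- Newly retained pairs: `min (number of successful modes) (m_max e)`. -/
def Network.retained (net : Network G) (x : net.ModeOutcomes) : External G :=
  fun e => min (Finset.univ.filter fun i => x e i = true).card (net.cap e)

/-! ### Internal phase -/

open Classical in
/-- The pairs on an edge after the purifications: a purified pair survives with the success
probability of the round, with improved fidelity; a pair given up is gone. -/
def Network.afterPurify (net : Network G) (n : External G) (s : net.Inventory) (a : net.Action)
    (w : net.Internal) (e : G.edgeSet) (r : net.PairName e) : Option Pair :=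
  match a.purify e r with
  | none => if ∃ r', a.purify e r' = some r then none else net.pool n s e r
  | some r' =>
      (net.pool n s e r).bind fun p => (net.pool n s e r').bind fun p' =>
        if (w.1 e r : ℝ) < net.noise.purifyProb p.2 p'.2 then
          some (p.1, net.noise.purifyFidelity p.2 p'.2)
        else none

/-- End of a slot: the pair ages by one slot and decoheres; it is lost when its lifetime is over
or its fidelity is below the threshold. -/
def Network.store (net : Network G) (p : Pair) : Option Pair :=
  if p.1 + 1 < net.memory ∧ net.threshold ≤ net.decay p.2 then some (p.1 + 1, net.decay p.2)
  else none

/-- The stored pairs at the beginning of the next slot. -/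
def Network.next (net : Network G) (n : External G) (s : net.Inventory) (a : net.Action)
    (w : net.Internal) : net.Inventory :=
  fun e i => (a.keep e i).bind fun r => (net.afterPurify n s a w e r).bind net.store

open Classical in
/-- End-to-end fidelity of an activated path: the Werner parameters of its edges multiply. -/
def Network.endFidelity [Fintype V] [DecidableEq V] [DecidableRel G.Adj] (net : Network G)
    (n : External G) (s : net.Inventory) (a : net.Action) (w : net.Internal)
    (A : net.Activation) : ℝ :=
  wernerFidelity (∏ e : G.edgeSet, if A.Uses e then
    ((net.afterPurify n s a w e (A.pick e)).elim 0 fun p => wernerParam p.2) else 1)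

/-- A usable delivery to `flow`: the action selects a simple path for it, contained in the
support of the external multigraph, which has a pair on every edge, all of whose swaps succeed,
and whose end-to-end fidelity reaches the threshold. -/
def Network.Usable [Fintype V] [DecidableEq V] [DecidableRel G.Adj] (net : Network G)
    (flow : V × V) (n : External G) (s : net.Inventory) (a : net.Action) (w : net.Internal) :
    Prop :=
  ∃ j A, a.activate j = some A ∧ A.flow = flow ∧
    (∀ e, A.Uses e → 1 ≤ n e ∧ (net.afterPurify n s a w e (A.pick e)).isSome) ∧
    (∀ v ∈ (A.path : G.Walk A.flow.1 A.flow.2).support,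
      v ≠ flow.1 → v ≠ flow.2 → w.2 j v = true) ∧
    net.threshold ≤ net.endFidelity n s a w A

/-! ### The controlled system -/

/-- The state of the system in a slot: external multigraph, stored pairs, action. -/
abbrev Network.State (net : Network G) : Type _ := External G × net.Inventory × net.Action

/-- The state of a slot, from the stored pairs and the randomness of the slot. -/
def Network.observe (net : Network G) (φ : net.Policy) (s : net.Inventory) (x : net.SlotNoise) :
    net.State :=
  (net.retained x.1.1, s, φ.act (net.retained x.1.1, s, x.1.2))

/-- Stored pairs at the beginning of slot `t`, started from `s₀` and driven by `ξ`. -/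
def Network.inventory {Ω : Type*} (net : Network G) (φ : net.Policy) (s₀ : Ω → net.Inventory)
    (ξ : ℕ → Ω → net.SlotNoise) : ℕ → Ω → net.Inventory
  | 0, ω => s₀ ω
  | t + 1, ω =>
      let z := net.observe φ (net.inventory φ s₀ ξ t ω) (ξ t ω)
      net.next z.1 z.2.1 z.2.2 (ξ t ω).2

/-- The state `Z_t` of the system. -/
def Network.state {Ω : Type*} (net : Network G) (φ : net.Policy) (s₀ : Ω → net.Inventory)
    (ξ : ℕ → Ω → net.SlotNoise) (t : ℕ) (ω : Ω) : net.State :=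
  net.observe φ (net.inventory φ s₀ ξ t ω) (ξ t ω)

open Classical in
/-- The indicator `Y_t ∈ {0, 1}` of a usable delivery to `flow` in slot `t`. -/
def Network.delivery {Ω : Type*} [Fintype V] [DecidableEq V] [DecidableRel G.Adj]
    (net : Network G) (φ : net.Policy) (flow : V × V) (s₀ : Ω → net.Inventory)
    (ξ : ℕ → Ω → net.SlotNoise) (t : ℕ) (ω : Ω) : ℕ :=
  let z := net.state φ s₀ ξ t ω
  if net.Usable flow z.1 z.2.1 z.2.2 (ξ t ω).2 then 1 else 0

/-- The slots are driven by i.i.d. randomness with the law of the model, independent of the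
pairs that are stored initially (whose law is not prescribed). -/
structure Network.IsDriven {Ω : Type*} [MeasurableSpace Ω] [Fintype V] [DecidableEq V]
    [DecidableRel G.Adj] (net : Network G) (P : Measure Ω) (s₀ : Ω → net.Inventory)
    (ξ : ℕ → Ω → net.SlotNoise) : Prop where
  measurable_init : Measurable s₀
  measurable_noise : ∀ t, Measurable (ξ t)
  law_noise : ∀ t, P.map (ξ t) = net.slotLaw
  indep_noise : iIndepFun ξ P
  indep_init : IndepFun s₀ (fun ω t => ξ t ω) P

/-- A sequence of random variables is stationary and ergodic: the shift on the path space is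
measure preserving and ergodic for the law of the sequence. -/
def IsStationaryErgodic {Ω S : Type*} [MeasurableSpace Ω] [MeasurableSpace S] (P : Measure Ω)
    (Z : ℕ → Ω → S) : Prop :=
  Ergodic (fun (z : ℕ → S) (t : ℕ) => z (t + 1)) (P.map fun ω t => Z t ω)

/-! ### Inter-delivery time and Fidelity-Age -/

/-- Number of slots from slot `t` to the next delivery, `inf {ℓ ≥ 1 : Y_{t+ℓ} = 1}`, which is
infinite if there is none. -/
def interDelivery (y : ℕ → ℕ) (t : ℕ) : ℕ∞ := ⨅ ℓ ∈ {ℓ : ℕ | 1 ≤ ℓ ∧ y (t + ℓ) = 1}, (ℓ : ℕ∞)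

/-- Number of slots since the last delivery; it is `t` if there is none up to slot `t`, since
`sSup ∅ = 0` in `ℕ`. -/
def slotAge (y : ℕ → ℕ) (t : ℕ) : ℕ := t - sSup {r : ℕ | r ≤ t ∧ y r = 1}

/-- Fidelity-Age at the time `u ≥ 0`, for slots of duration `Δ` (slot `t` begins at the time
`t Δ`): it vanishes at a delivery and grows at unit rate, also within a slot, until the next. -/
def fidelityAge (Δ : ℝ) (y : ℕ → ℕ) (u : ℝ) : ℝ :=
  Δ * slotAge y ⌊u / Δ⌋₊ + (u - Δ * ⌊u / Δ⌋₊)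

end FidelityAge

end

/-
With `y` the delivery indicators along a sample path, the integral of the Fidelity-Age over slot
`t` is, in units of `Δ²`, half of `(slotAge y t + 1) ^ 2 - slotAge y t ^ 2`. Within a cycle between
two deliveries these increments telescope to the squared length of the cycle, so the time average
is half of the average over all slots of `τ ^ 2`, counted at the slots that deliver. By Birkhoff's
theorem this is `E[τ ^ 2 | Y = 1] * Pr(Y = 1) / 2`, and the same telescoping with first powers gives
`E[τ | Y = 1] * Pr(Y = 1) = 1`.

Birkhoff's theorem needs the deliveries to be ergodic, but they depend on the purification and swap
outcomes, which the state process does not record. Let the stored pairs be driven by the i.i.d.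
slot randomness through the skew shift `(s, x) ↦ (F (s, x 0), x (· + 1))`. Given the first `n`
inputs, the conditional probability of an invariant event is a fixed function of the `n`-th stored
state. By Lévy's 0-1 law it converges to the indicator of the event, so by stationarity it is `0` or
`1` from the start. Hence invariant events are determined by the initial stored pairs, and
ergodicity of the state process makes them trivial.
-/

namespace FidelityAge

section PointwiseErgodic

variable {α : Type*} {T : α → α} {f : α → ℝ}

lemma partialSups_birkhoffSum_succ (n : ℕ) (x : α) :
    partialSups (birkhoffSum T f) (n + 1) x =
      max 0 (f x + partialSups (birkhoffSum T f) n (T x)) := by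
  simp only [Pi.partialSups_apply]
  rw [partialSups_add_one', ← partialSups_const_add]
  simp [Function.comp_def, birkhoffSum_succ']

lemma partialSups_birkhoffSum_nonneg (n : ℕ) (x : α) :
    0 ≤ partialSups (birkhoffSum T f) n x :=
  le_partialSups_of_le (birkhoffSum T f) n.zero_le x

lemma partialSups_birkhoffSum_succ_sub (n : ℕ) (x : α) :
    partialSups (birkhoffSum T f) (n + 1) x - partialSups (birkhoffSum T f) n (T x) =
      max (-partialSups (birkhoffSum T f) n (T x)) (f x) := by
  rw [partialSups_birkhoffSum_succ, ← max_sub_sub_right, zero_sub, add_sub_cancel_right]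

lemma bddAbove_birkhoffSum_apply_iff (x : α) :
    BddAbove (Set.range fun n => birkhoffSum T f n (T x)) ↔
      BddAbove (Set.range fun n => birkhoffSum T f n x) := by
  constructor
  · rintro ⟨K, hK⟩
    refine ⟨max 0 (f x + K), Set.forall_mem_range.2 fun n => ?_⟩
    cases n with
    | zero => simp
    | succ n =>
      rw [birkhoffSum_succ']
      exact le_max_of_le_right (add_le_add_right (hK ⟨n, rfl⟩) _)
  · rintro ⟨K, hK⟩
    refine ⟨K - f x, Set.forall_mem_range.2 fun n => ?_⟩
    rw [le_sub_iff_add_le', ← birkhoffSum_succ']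
    exact hK ⟨n + 1, rfl⟩

variable [MeasurableSpace α] {μ : Measure α}

lemma integrable_birkhoffSum (hT : MeasurePreserving T μ μ) (hf : Integrable f μ) (n : ℕ) :
    Integrable (birkhoffSum T f n) μ :=
  integrable_finsetSum _ fun k _ => (hT.iterate k).integrable_comp_of_integrable hf

lemma integrable_partialSups_birkhoffSum (hT : MeasurePreserving T μ μ) (hf : Integrable f μ)
    (n : ℕ) : Integrable (partialSups (birkhoffSum T f) n) μ := by
  induction n with
  | zero => exact integrable_birkhoffSum hT hf 0
  | succ n ih =>
    rw [partialSups_add_one]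
    exact ih.sup (integrable_birkhoffSum hT hf _)

/- With `M n` the maximum of the first `n` Birkhoff sums, `M (n + 1) - M n ∘ T` has nonnegative
integral, and it equals `f` as soon as `M n ∘ T ≥ -f`. -/
lemma integral_nonneg_of_ae_not_bddAbove_birkhoffSum (hT : MeasurePreserving T μ μ)
    (hf : Integrable f μ)
    (h : ∀ᵐ x ∂μ, ¬ BddAbove (Set.range fun n => birkhoffSum T f n x)) :
    0 ≤ ∫ x, f x ∂μ := by
  set M := partialSups (birkhoffSum T f)
  have hM := integrable_partialSups_birkhoffSum hT hf
  have hMT (n : ℕ) : Integrable (fun x => M n (T x)) μ := hT.integrable_comp_of_integrable (hM n)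
  have hlim : Tendsto (fun n => ∫ x, (M (n + 1) x - M n (T x)) ∂μ) atTop (𝓝 (∫ x, f x ∂μ)) := by
    refine tendsto_integral_of_dominated_convergence (fun x => |f x|)
      (fun n => ((hM (n + 1)).sub (hMT n)).aestronglyMeasurable) hf.abs
      (fun n => ae_of_all _ fun x => ?_) ?_
    · rw [partialSups_birkhoffSum_succ_sub, Real.norm_eq_abs]
      have hneg := neg_nonpos.2 (partialSups_birkhoffSum_nonneg (T := T) (f := f) n (T x))
      exact abs_le.2 ⟨le_max_of_le_right (neg_abs_le _),
        max_le (hneg.trans (abs_nonneg _)) (le_abs_self _)⟩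
    · filter_upwards [h] with x hx
      have hMx : Tendsto (fun n => M n (T x)) atTop atTop := by
        refine tendsto_atTop_atTop_of_monotone' (fun m n hmn => M.monotone hmn (T x)) ?_
        simpa only [M, Pi.partialSups_apply, bddAbove_range_partialSups,
          bddAbove_birkhoffSum_apply_iff] using hx
      refine tendsto_const_nhds.congr' ?_
      filter_upwards [hMx.eventually_ge_atTop (-f x)] with n hn
      rw [partialSups_birkhoffSum_succ_sub, max_eq_right (neg_le.1 hn)]
  refine ge_of_tendsto' hlim fun n => ?_
  have hinv : ∫ x, M n (T x) ∂μ = ∫ x, M n x ∂μ := by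
    rw [← integral_map hT.aemeasurable (hT.map_eq.symm ▸ (hM n).aestronglyMeasurable), hT.map_eq]
  rw [integral_sub (hM _) (hMT n), hinv, sub_nonneg]
  exact integral_mono (hM n) (hM _) (M.monotone n.le_succ)

lemma ae_bddAbove_birkhoffSum (hT : Ergodic T μ) (hfm : Measurable f) (hf : Integrable f μ)
    (hneg : ∫ x, f x ∂μ < 0) :
    ∀ᵐ x ∂μ, BddAbove (Set.range fun n => birkhoffSum T f n x) := by
  have hS (n : ℕ) : Measurable (birkhoffSum T f n) :=
    Finset.measurable_sum _ fun k _ => hfm.comp (hT.measurable.iterate k)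
  refine (hT.toPreErgodic.ae_mem_or_ae_notMem (measurableSet_bddAbove_range hS)
    (Set.ext bddAbove_birkhoffSum_apply_iff)).resolve_right fun h => ?_
  exact hneg.not_ge (integral_nonneg_of_ae_not_bddAbove_birkhoffSum hT.toMeasurePreserving hf h)

variable [IsProbabilityMeasure μ]

lemma ae_eventually_birkhoffAverage_le (hT : Ergodic T μ) (hfm : Measurable f)
    (hf : Integrable f μ) {ε : ℝ} (hε : 0 < ε) :
    ∀ᵐ x ∂μ, ∀ᶠ n in atTop, birkhoffAverage ℝ T f n x ≤ ∫ x, f x ∂μ + ε := by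
  set c := ∫ x, f x ∂μ + ε / 2
  have hneg : ∫ x, (f x - c) ∂μ < 0 := by
    rw [integral_sub hf (integrable_const _)]
    simp [c, hε]
  filter_upwards [ae_bddAbove_birkhoffSum hT (hfm.sub_const c) (hf.sub (integrable_const c)) hneg]
    with x ⟨K, hK⟩
  filter_upwards [(tendsto_const_div_atTop_nhds_zero_nat K).eventually_le_const
    (half_pos hε), eventually_gt_atTop 0] with n hKn hn
  have hn' : (0 : ℝ) < n := Nat.cast_pos.2 hn
  have hsum : birkhoffSum T f n x - n * c ≤ K := by
    simpa [birkhoffSum, Finset.sum_sub_distrib] using hK ⟨n, rfl⟩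
  rw [div_le_iff₀ hn'] at hKn
  rw [birkhoffAverage, smul_eq_mul, inv_mul_le_iff₀ hn']
  calc birkhoffSum T f n x ≤ ε / 2 * n + n * c := by linarith
    _ = n * (∫ x, f x ∂μ + ε) := by ring

theorem ae_tendsto_birkhoffAverage (hT : Ergodic T μ) (hf : Integrable f μ) :
    ∀ᵐ x ∂μ, Tendsto (birkhoffAverage ℝ T f · x) atTop (𝓝 (∫ x, f x ∂μ)) := by
  wlog hfm : Measurable f generalizing f
  · obtain ⟨g, hgm, hfg⟩ := hf.aestronglyMeasurable.aemeasurable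
    have havg := ae_all_iff.2
      (hT.quasiMeasurePreserving.birkhoffAverage_ae_eq_of_ae_eq ℝ hfg)
    filter_upwards [this (hf.congr hfg) hgm, havg] with x hx hfgx
    simpa only [hfgx, integral_congr_ae hfg] using hx
  have hpos (k : ℕ) : (0 : ℝ) < 1 / (k + 1) := Nat.one_div_pos_of_nat
  filter_upwards
    [ae_all_iff.2 fun k => ae_eventually_birkhoffAverage_le hT hfm hf (hpos k),
      ae_all_iff.2 fun k => ae_eventually_birkhoffAverage_le hT hfm.neg hf.neg (hpos k)]
    with x hupper hlower
  refine Metric.tendsto_nhds.2 fun ε hε => ?_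
  obtain ⟨k, hk⟩ := exists_nat_one_div_lt hε
  filter_upwards [hupper k, hlower k] with n hu hl
  simp only [birkhoffAverage_neg, Pi.neg_apply, integral_neg] at hl
  rw [Real.dist_eq, abs_lt]
  constructor <;> linarith

end PointwiseErgodic

section Sublinear

variable {a b : ℕ → ℝ}

lemma tendsto_div_of_tendsto_sum_div {c : ℝ}
    (h : Tendsto (fun n : ℕ => (∑ t ∈ Finset.range n, a t) / n) atTop (𝓝 c)) :
    Tendsto (fun n : ℕ => a n / (n + 1)) atTop (𝓝 0) := by
  have hdiff := ((tendsto_add_atTop_iff_nat 1).2 h).sub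
    (h.mul (tendsto_natCast_div_add_atTop (1 : ℝ)))
  rw [mul_one, sub_self] at hdiff
  refine hdiff.congr' ?_
  filter_upwards [eventually_gt_atTop 0] with n hn
  rw [Finset.sum_range_succ]
  push_cast
  field_simp
  ring

lemma exists_forall_le_add_mul (h : Tendsto (fun n : ℕ => a n / (n + 1)) atTop (𝓝 0)) {ε : ℝ}
    (hε : 0 < ε) : ∃ K, ∀ n : ℕ, a n ≤ K + ε * (n + 1) := by
  have hev : ∀ᶠ n : ℕ in atTop, a n - ε * (n + 1) ≤ 0 := by
    filter_upwards [h.eventually_le_const hε] with n hn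
    rwa [div_le_iff₀ (by positivity), ← sub_nonpos] at hn
  obtain ⟨K, hK⟩ := (isBoundedUnder_of_eventually_le hev).bddAbove_range
  exact ⟨K, fun n => sub_le_iff_le_add.1 (hK ⟨n, rfl⟩)⟩

lemma tendsto_div_of_forall_le_add_mul (hb : ∀ n, 0 ≤ b n)
    (h : ∀ ε > 0, ∃ K, ∀ n : ℕ, b n ≤ K + ε * n) :
    Tendsto (fun n : ℕ => b n / n) atTop (𝓝 0) := by
  refine Metric.tendsto_nhds.2 fun ε hε => ?_
  obtain ⟨K, hK⟩ := h (ε / 2) (half_pos hε)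
  filter_upwards [(tendsto_const_div_atTop_nhds_zero_nat K).eventually_lt_const (half_pos hε),
    eventually_gt_atTop 0] with n hKn hn
  have hn' : (0 : ℝ) < n := Nat.cast_pos.2 hn
  rw [div_lt_iff₀ hn'] at hKn
  rw [dist_zero_right, Real.norm_of_nonneg (div_nonneg (hb n) hn'.le), div_lt_iff₀ hn']
  linarith [hK n]

lemma tendsto_div_of_le_or_exists_lt_le (ha : Tendsto (fun n : ℕ => a n / (n + 1)) atTop (𝓝 0))
    (hb : ∀ n, 0 ≤ b n) {C : ℝ} (hba : ∀ n, b n ≤ C ∨ ∃ t < n, b n ≤ a t) :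
    Tendsto (fun n : ℕ => b n / n) atTop (𝓝 0) := by
  refine tendsto_div_of_forall_le_add_mul hb fun ε hε => ?_
  obtain ⟨K, hK⟩ := exists_forall_le_add_mul ha hε
  refine ⟨max C K, fun n => ?_⟩
  rcases hba n with hC | ⟨t, htn, hat⟩
  · exact hC.trans ((le_max_left C K).trans (le_add_of_nonneg_right (by positivity)))
  · have htn' : (t : ℝ) + 1 ≤ n := mod_cast htn
    calc b n ≤ K + ε * (t + 1) := hat.trans (hK t)
      _ ≤ max C K + ε * n := by gcongr; exact le_max_right C K

end Sublinear

section Cycles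

variable {y : ℕ → ℕ} {t : ℕ}

lemma slotAge_zero (y : ℕ → ℕ) : slotAge y 0 = 0 := Nat.zero_sub _

lemma slotAge_eq_zero (h : y t = 1) : slotAge y t = 0 :=
  Nat.sub_eq_zero_of_le (le_csSup ⟨t, fun _ hr => hr.1⟩ ⟨le_rfl, h⟩)

lemma slotAge_succ (h : y (t + 1) ≠ 1) : slotAge y (t + 1) = slotAge y t + 1 := by
  have hset : {r | r ≤ t + 1 ∧ y r = 1} = {r | r ≤ t ∧ y r = 1} := by
    ext r
    have hr : y r = 1 → r ≠ t + 1 := fun hr hrt => h (hrt ▸ hr)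
    simp only [Set.mem_ofPred_eq]
    grind
  have hle : sSup {r | r ≤ t ∧ y r = 1} ≤ t := csSup_le' fun _ hr => hr.1
  rw [slotAge, slotAge, hset, Nat.succ_sub hle]

lemma interDelivery_eq_one (h : y (t + 1) = 1) : interDelivery y t = 1 :=
  le_antisymm (iInf₂_le 1 ⟨le_rfl, h⟩) (le_iInf₂ fun _ hℓ => Nat.one_le_cast.2 hℓ.1)

lemma interDelivery_eq_add_one (h : y (t + 1) ≠ 1) :
    interDelivery y t = interDelivery y (t + 1) + 1 := by
  refine le_antisymm ?_ (le_iInf₂ fun ℓ hℓ => ?_)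
  · simp only [interDelivery, ENat.iInf_add]
    refine le_iInf₂ fun ℓ hℓ => iInf₂_le_of_le (ℓ + 1) ⟨ℓ.succ_pos, ?_⟩ (by push_cast; rfl)
    rw [← add_assoc, add_right_comm]
    exact hℓ.2
  · obtain ⟨k, rfl⟩ := Nat.exists_eq_add_of_le' hℓ.1
    have hk : 1 ≤ k := Nat.one_le_iff_ne_zero.2 fun hk => h (by simpa [hk] using hℓ.2)
    push_cast
    gcongr
    exact iInf₂_le k ⟨hk, by rw [add_right_comm]; exact hℓ.2⟩

lemma interDelivery_ne_top (hy : ∃ᶠ t in atTop, y t = 1) (t : ℕ) : interDelivery y t ≠ ⊤ := by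
  obtain ⟨r, htr, hr⟩ := frequently_atTop.1 hy (t + 1)
  have hle : interDelivery y t ≤ (r - t : ℕ) :=
    iInf₂_le (r - t) ⟨by omega, by rwa [Nat.add_sub_cancel' (by omega)]⟩
  exact (hle.trans_lt (ENat.natCast_lt_top _)).ne

/-- The number of slots between the last delivery up to slot `t` (or slot `0`, if there is none)
and the next delivery. -/
noncomputable def cycleLength (y : ℕ → ℕ) (t : ℕ) : ℕ := slotAge y t + (interDelivery y t).toNat

/-- The `k`-th power of the length of the cycle that begins in slot `t`, if slot `t` delivers;
it is `0` if that cycle never ends, since `ENat.toNat ⊤ = 0`. -/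
noncomputable def cycleMoment (k : ℕ) (y : ℕ → ℕ) (t : ℕ) : ℝ :=
  if y t = 1 then ((interDelivery y t).toNat : ℝ) ^ k else 0

lemma cycleLength_of_delivery (h : y (t + 1) = 1) : cycleLength y t = slotAge y t + 1 := by
  rw [cycleLength, interDelivery_eq_one h, ENat.toNat_one]

lemma cycleLength_pow_of_delivery (h : y t = 1) (k : ℕ) :
    (cycleLength y t : ℝ) ^ k = cycleMoment k y t := by
  rw [cycleLength, slotAge_eq_zero h, zero_add, cycleMoment, if_pos h]

lemma cycleLength_succ (hy : ∃ᶠ t in atTop, y t = 1) (h : y (t + 1) ≠ 1) :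
    cycleLength y (t + 1) = cycleLength y t := by
  rw [cycleLength, cycleLength, slotAge_succ h, interDelivery_eq_add_one h,
    ENat.toNat_add (interDelivery_ne_top hy _) ENat.one_ne_top, ENat.toNat_one]
  ring

lemma cycleLength_eq_or_exists_lt (hy : ∃ᶠ t in atTop, y t = 1) (k n : ℕ) :
    cycleLength y n = cycleLength y 0 ∨
      ∃ t < n, (cycleLength y n : ℝ) ^ k = cycleMoment k y (t + 1) := by
  induction n with
  | zero => exact Or.inl rfl
  | succ n ih =>
    by_cases h : y (n + 1) = 1
    · exact Or.inr ⟨n, n.lt_succ_self, cycleLength_pow_of_delivery h k⟩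
    · rw [cycleLength_succ hy h]
      exact ih.imp_right fun ⟨t, ht, hkt⟩ => ⟨t, ht.trans n.lt_succ_self, hkt⟩

lemma tendsto_cycleLength_pow_div (hy : ∃ᶠ t in atTop, y t = 1) {k : ℕ} {c : ℝ}
    (h : Tendsto (fun n : ℕ => (∑ t ∈ Finset.range n, cycleMoment k y (t + 1)) / n) atTop (𝓝 c)) :
    Tendsto (fun n : ℕ => (cycleLength y n : ℝ) ^ k / n) atTop (𝓝 0) :=
  tendsto_div_of_le_or_exists_lt_le (tendsto_div_of_tendsto_sum_div h) (fun _ => by positivity)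
    (C := (cycleLength y 0 : ℝ) ^ k) fun n => (cycleLength_eq_or_exists_lt hy k n).imp
      (fun h0 => by rw [h0]) fun ⟨t, ht, hkt⟩ => ⟨t, ht, hkt.le⟩

/- Over a complete cycle the increments of `slotAge ^ k` telescope to the `k`-th power of its
length; the terms outside the sums are those of the incomplete cycles at both ends. -/
lemma sum_slotAge_pow_sub_add (hy : ∃ᶠ t in atTop, y t = 1) {k : ℕ} (hk : k ≠ 0) (n : ℕ) :
    ∑ t ∈ Finset.range n, (((slotAge y t : ℝ) + 1) ^ k - (slotAge y t : ℝ) ^ k) +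
        ((cycleLength y n : ℝ) ^ k - (slotAge y n : ℝ) ^ k) =
      ∑ t ∈ Finset.range n, cycleMoment k y (t + 1) + (cycleLength y 0 : ℝ) ^ k := by
  induction n with
  | zero => simp [slotAge_zero, hk]
  | succ n ih =>
    rw [Finset.sum_range_succ, Finset.sum_range_succ]
    by_cases h : y (n + 1) = 1
    · rw [cycleLength_of_delivery h] at ih
      rw [cycleLength_pow_of_delivery h, slotAge_eq_zero h, Nat.cast_zero, zero_pow hk]
      push_cast at ih
      linarith
    · rw [cycleLength_succ hy h, slotAge_succ h, cycleMoment, if_neg h]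
      push_cast
      linarith

lemma tendsto_sum_slotAge_pow_sub_div (hy : ∃ᶠ t in atTop, y t = 1) {k : ℕ} (hk : k ≠ 0) {c : ℝ}
    (h : Tendsto (fun n : ℕ => (∑ t ∈ Finset.range n, cycleMoment k y (t + 1)) / n) atTop (𝓝 c)) :
    Tendsto (fun n : ℕ =>
      (∑ t ∈ Finset.range n, (((slotAge y t : ℝ) + 1) ^ k - (slotAge y t : ℝ) ^ k)) / n)
      atTop (𝓝 c) := by
  have hend : Tendsto (fun n : ℕ => ((cycleLength y n : ℝ) ^ k - (slotAge y n : ℝ) ^ k) / n)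
      atTop (𝓝 0) := by
    refine squeeze_zero (fun n => ?_) (fun n => ?_) (tendsto_cycleLength_pow_div hy h)
    · have hle : (slotAge y n : ℝ) ≤ cycleLength y n := mod_cast Nat.le_add_right _ _
      exact div_nonneg (sub_nonneg.2 (by gcongr)) n.cast_nonneg
    · gcongr
      exact sub_le_self _ (by positivity)
  have hlim := (h.add
    (tendsto_const_div_atTop_nhds_zero_nat ((cycleLength y 0 : ℝ) ^ k))).sub hend
  rw [add_zero, sub_zero] at hlim
  refine hlim.congr fun n => ?_
  rw [← add_div, ← sub_div, ← sum_slotAge_pow_sub_add hy hk, add_sub_cancel_right]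

end Cycles

section TimeAverage

lemma tendsto_inv_mul_of_monotoneOn {g : ℝ → ℝ} {c : ℝ} (hg : MonotoneOn g (Set.Ici 0))
    (h : Tendsto (fun n : ℕ => g n / n) atTop (𝓝 c)) :
    Tendsto (fun x => x⁻¹ * g x) atTop (𝓝 c) := by
  have hfloor : Tendsto (fun x : ℝ => ⌊x⌋₊) atTop atTop := tendsto_nat_floor_atTop
  have hratio : Tendsto (fun x : ℝ => (⌊x⌋₊ : ℝ) / x) atTop (𝓝 1) := tendsto_nat_floor_div_atTop
  have hlower := (h.comp hfloor).mul hratio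
  have hupper := (h.comp ((tendsto_add_atTop_nat 1).comp hfloor)).mul
    (hratio.add tendsto_inv_atTop_zero)
  rw [mul_one] at hlower
  rw [add_zero, mul_one] at hupper
  refine tendsto_of_tendsto_of_tendsto_of_le_of_le' hlower hupper ?_ ?_
  · filter_upwards [hfloor.eventually_gt_atTop 0, eventually_gt_atTop 0] with x hn hx
    have hn' : (⌊x⌋₊ : ℝ) ≠ 0 := Nat.cast_ne_zero.2 hn.ne'
    calc g ⌊x⌋₊ / ⌊x⌋₊ * (⌊x⌋₊ / x) = x⁻¹ * g ⌊x⌋₊ := by field_simp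
      _ ≤ x⁻¹ * g x := by
        gcongr
        exact hg (Set.mem_Ici.2 (Nat.cast_nonneg _)) hx.le (Nat.floor_le hx.le)
  · filter_upwards [eventually_gt_atTop 0] with x hx
    calc x⁻¹ * g x ≤ x⁻¹ * g (⌊x⌋₊ + 1 : ℕ) := by
          gcongr
          exact hg hx.le (Set.mem_Ici.2 (Nat.cast_nonneg _)) (mod_cast (Nat.lt_floor_add_one x).le)
      _ = g (⌊x⌋₊ + 1 : ℕ) / (⌊x⌋₊ + 1 : ℕ) * (⌊x⌋₊ / x + x⁻¹) := by
        push_cast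
        field_simp

lemma slotAge_le (y : ℕ → ℕ) (t : ℕ) : slotAge y t ≤ t := Nat.sub_le _ _

lemma fidelityAge_one (y : ℕ → ℕ) (u : ℝ) :
    fidelityAge 1 y u = slotAge y ⌊u⌋₊ + (u - ⌊u⌋₊) := by
  simp only [fidelityAge, div_one, one_mul]

lemma fidelityAge_eq_mul {Δ : ℝ} (hΔ : Δ ≠ 0) (y : ℕ → ℕ) (u : ℝ) :
    fidelityAge Δ y u = Δ * fidelityAge 1 y (u / Δ) := by
  rw [fidelityAge_one, fidelityAge, mul_add, mul_sub, mul_div_cancel₀ u hΔ]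

lemma fidelityAge_one_nonneg (y : ℕ → ℕ) {u : ℝ} (hu : 0 ≤ u) : 0 ≤ fidelityAge 1 y u := by
  rw [fidelityAge_one]
  exact add_nonneg (Nat.cast_nonneg _) (sub_nonneg.2 (Nat.floor_le hu))

lemma fidelityAge_one_le (y : ℕ → ℕ) (u : ℝ) : fidelityAge 1 y u ≤ u := by
  have hle : (slotAge y ⌊u⌋₊ : ℝ) ≤ ⌊u⌋₊ := Nat.cast_le.2 (slotAge_le y _)
  rw [fidelityAge_one]
  linarith

lemma measurable_fidelityAge_one (y : ℕ → ℕ) : Measurable (fidelityAge 1 y) := by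
  have hcast (a : ℕ → ℕ) : Measurable fun u : ℝ => (a ⌊u⌋₊ : ℝ) :=
    (measurable_from_top (f := fun n => (a n : ℝ))).comp Nat.measurable_floor
  simp only [funext (fidelityAge_one y)]
  exact (hcast (slotAge y)).add (measurable_id.sub (hcast id))

lemma intervalIntegrable_fidelityAge_one (y : ℕ → ℕ) {a b : ℝ} (ha : 0 ≤ a) (hb : 0 ≤ b) :
    IntervalIntegrable (fidelityAge 1 y) volume a b := by
  refine (continuous_id.intervalIntegrable a b).mono_fun
    (measurable_fidelityAge_one y).aestronglyMeasurable
    ((ae_restrict_iff' measurableSet_uIoc).2 (ae_of_all _ fun u hu => ?_))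
  have hu0 : 0 ≤ u := (le_min ha hb).trans hu.1.le
  change ‖fidelityAge 1 y u‖ ≤ ‖u‖
  rw [Real.norm_of_nonneg (fidelityAge_one_nonneg y hu0)]
  exact (fidelityAge_one_le y u).trans (le_abs_self u)

lemma monotoneOn_integral_fidelityAge_one (y : ℕ → ℕ) :
    MonotoneOn (fun T : ℝ => ∫ u in (0 : ℝ)..T, fidelityAge 1 y u) (Set.Ici 0) := by
  intro a ha b _ hab
  refine intervalIntegral.integral_mono_interval le_rfl ha hab ?_
    (intervalIntegrable_fidelityAge_one y le_rfl (ha.trans hab))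
  exact (ae_restrict_iff' measurableSet_Ioc).2
    (ae_of_all _ fun u hu => fidelityAge_one_nonneg y hu.1.le)

lemma integral_fidelityAge_one_slot (y : ℕ → ℕ) (n : ℕ) :
    ∫ u in (n : ℝ)..(n + 1 : ℕ), fidelityAge 1 y u =
      (((slotAge y n : ℝ) + 1) ^ 2 - (slotAge y n : ℝ) ^ 2) / 2 := by
  have hle : (n : ℝ) ≤ (n + 1 : ℕ) := Nat.cast_le.2 n.le_succ
  have hslot : ∫ u in (n : ℝ)..(n + 1 : ℕ), fidelityAge 1 y u =
      ∫ u in (n : ℝ)..(n + 1 : ℕ), ((slotAge y n : ℝ) - n + u) := by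
    rw [intervalIntegral.integral_of_le hle, intervalIntegral.integral_of_le hle,
      integral_Ioc_eq_integral_Ioo, integral_Ioc_eq_integral_Ioo]
    refine setIntegral_congr_fun measurableSet_Ioo fun u hu => ?_
    have hfloor : ⌊u⌋₊ = n := (Nat.floor_eq_iff (n.cast_nonneg.trans hu.1.le)).2
      ⟨hu.1.le, by simpa only [Nat.cast_succ] using hu.2⟩
    simp only [fidelityAge_one, hfloor]
    ring
  rw [hslot, intervalIntegral.integral_add (g := fun u => u) intervalIntegrable_const
    (continuous_id.intervalIntegrable _ _), intervalIntegral.integral_const, integral_id]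
  push_cast
  rw [smul_eq_mul]
  ring

lemma integral_fidelityAge_one_natCast (y : ℕ → ℕ) (n : ℕ) :
    ∫ u in (0 : ℝ)..n, fidelityAge 1 y u =
      (∑ t ∈ Finset.range n, (((slotAge y t : ℝ) + 1) ^ 2 - (slotAge y t : ℝ) ^ 2)) / 2 := by
  have hsum := intervalIntegral.sum_integral_adjacent_intervals (a := fun k : ℕ => (k : ℝ)) (n := n)
    fun k _ => intervalIntegrable_fidelityAge_one y k.cast_nonneg (k + 1).cast_nonneg
  rw [Nat.cast_zero] at hsum
  rw [← hsum, Finset.sum_div]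
  exact Finset.sum_congr rfl fun t _ => integral_fidelityAge_one_slot y t

lemma average_fidelityAge_eq_mul {Δ : ℝ} (hΔ : Δ ≠ 0) (y : ℕ → ℕ) (T : ℝ) :
    T⁻¹ * ∫ u in (0 : ℝ)..T, fidelityAge Δ y u =
      Δ * ((T / Δ)⁻¹ * ∫ u in (0 : ℝ)..(T / Δ), fidelityAge 1 y u) := by
  simp only [fidelityAge_eq_mul hΔ, intervalIntegral.integral_const_mul,
    intervalIntegral.integral_comp_div _ hΔ, zero_div, smul_eq_mul, inv_div]
  ring

lemma tendsto_average_fidelityAge {Δ : ℝ} (hΔ : 0 < Δ) {y : ℕ → ℕ} {c : ℝ}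
    (h : Tendsto (fun n : ℕ =>
      (∑ t ∈ Finset.range n, (((slotAge y t : ℝ) + 1) ^ 2 - (slotAge y t : ℝ) ^ 2)) / (n : ℝ))
      atTop (𝓝 c)) :
    Tendsto (fun T : ℝ => T⁻¹ * ∫ u in (0 : ℝ)..T, fidelityAge Δ y u) atTop (𝓝 (Δ * (c / 2))) := by
  simp only [average_fidelityAge_eq_mul hΔ.ne']
  refine ((tendsto_inv_mul_of_monotoneOn (monotoneOn_integral_fidelityAge_one y) ?_).comp
    (tendsto_id.atTop_div_const hΔ)).const_mul Δ
  refine (h.div_const 2).congr fun n => ?_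
  rw [integral_fidelityAge_one_natCast, div_right_comm]

end TimeAverage

section Recurrence

lemma ae_frequently_iterate_mem {α : Type*} [MeasurableSpace α] {μ : Measure α} [IsFiniteMeasure μ]
    {T : α → α} (hT : Ergodic T μ) {s : Set α} (hs : MeasurableSet s) (hμs : μ s ≠ 0) :
    ∀ᵐ x ∂μ, ∃ᶠ n in atTop, T^[n] x ∈ s := by
  have hmeas : MeasurableSet (limsup (fun n => T^[n] ⁻¹' s) atTop) :=
    .measurableSet_limsup fun n => hT.measurable.iterate n hs
  have hinv : T ⁻¹' limsup (fun n => T^[n] ⁻¹' s) atTop = limsup (fun n => T^[n] ⁻¹' s) atTop := by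
    ext x
    rw [Set.mem_preimage, mem_limsup_iff_frequently_mem, mem_limsup_iff_frequently_mem]
    conv_rhs => rw [← map_add_atTop_eq_nat 1, frequently_map]
    rfl
  simp only [← Set.mem_preimage, ← mem_limsup_iff_frequently_mem]
  refine (hT.ae_mem_or_ae_notMem hmeas hinv).resolve_right fun hnot => hμs ?_
  have hret := hT.toMeasurePreserving.conservative.ae_mem_imp_frequently_image_mem
    hs.nullMeasurableSet
  exact measure_eq_zero_iff_ae_notMem.2 ((hnot.and hret).mono fun x hx hxs =>
    hx.1 (mem_limsup_iff_frequently_mem.2 (hx.2 hxs)))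

end Recurrence

section PathSpace

/-- The left shift on sequences; `IsStationaryErgodic` says that it is ergodic for the law of the
process. -/
def shift {S : Type*} (z : ℕ → S) (t : ℕ) : S := z (t + 1)

lemma shift_iterate {S : Type*} (n : ℕ) (z : ℕ → S) (t : ℕ) : shift^[n] z t = z (t + n) := by
  induction n generalizing z with
  | zero => rfl
  | succ n ih => rw [Function.iterate_succ_apply, ih]; rfl

lemma interDelivery_shift_iterate (n : ℕ) (y : ℕ → ℕ) (t : ℕ) :
    interDelivery (shift^[n] y) t = interDelivery y (t + n) := by
  simp only [interDelivery, shift_iterate, add_right_comm]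

lemma cycleMoment_shift_iterate (k n : ℕ) (y : ℕ → ℕ) (t : ℕ) :
    cycleMoment k (shift^[n] y) t = cycleMoment k y (t + n) := by
  rw [cycleMoment, cycleMoment, interDelivery_shift_iterate, shift_iterate]

lemma one_le_interDelivery (y : ℕ → ℕ) (t : ℕ) : 1 ≤ (interDelivery y t : ℝ≥0∞) := by
  rw [← ENat.toENNReal_one, ENat.toENNReal_le]
  exact le_iInf₂ fun _ hℓ => Nat.one_le_cast.2 hℓ.1

lemma measurableSet_delivery (t : ℕ) : MeasurableSet {y : ℕ → ℕ | y t = 1} :=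
  measurableSet_eq_fun (measurable_pi_apply t) measurable_const

lemma measurable_interDelivery (t : ℕ) :
    Measurable fun y : ℕ → ℕ => (interDelivery y t : ℝ≥0∞) := by
  simp only [interDelivery, ENat.toENNReal_iInf]
  refine Measurable.iInf fun ℓ => ?_
  simp only [iInf_eq_if, Set.mem_ofPred_eq]
  exact Measurable.ite ((MeasurableSet.const _).inter (measurableSet_delivery _))
    measurable_const measurable_const

lemma cycleMoment_eq_indicator (k t : ℕ) :
    (fun y => cycleMoment k y t) = {y : ℕ → ℕ | y t = 1}.indicator
      fun y => ((interDelivery y t : ℝ≥0∞) ^ k).toReal := by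
  ext y
  have hcast : ((interDelivery y t).toNat : ℝ) = (interDelivery y t : ℝ≥0∞).toReal := by
    cases interDelivery y t <;> simp
  rw [cycleMoment, hcast, ← ENNReal.toReal_pow, Set.indicator_apply]
  rfl

variable {μ : Measure (ℕ → ℕ)} {k : ℕ}

lemma setLIntegral_interDelivery_pow (hμ : MeasurePreserving shift μ μ) (k t : ℕ) :
    ∫⁻ y in {y | y t = 1}, (interDelivery y t : ℝ≥0∞) ^ k ∂μ =
      ∫⁻ y in {y | y 0 = 1}, (interDelivery y 0 : ℝ≥0∞) ^ k ∂μ := by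
  rw [← (hμ.iterate t).setLIntegral_comp_preimage (measurableSet_delivery 0)
    ((measurable_interDelivery 0).pow_const k)]
  simp only [interDelivery_shift_iterate, Set.preimage_ofPred_eq, shift_iterate, zero_add]

lemma integrable_cycleMoment
    (h : ∫⁻ y in {y | y 0 = 1}, (interDelivery y 0 : ℝ≥0∞) ^ k ∂μ ≠ ∞) :
    Integrable (fun y => cycleMoment k y 0) μ := by
  rw [cycleMoment_eq_indicator, integrable_indicator_iff (measurableSet_delivery 0)]
  exact integrable_toReal_of_lintegral_ne_top
    ((measurable_interDelivery 0).pow_const k).aemeasurable h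

lemma integral_cycleMoment
    (h : ∫⁻ y in {y | y 0 = 1}, (interDelivery y 0 : ℝ≥0∞) ^ k ∂μ ≠ ∞) :
    ∫ y, cycleMoment k y 0 ∂μ =
      (∫⁻ y in {y | y 0 = 1}, (interDelivery y 0 : ℝ≥0∞) ^ k ∂μ).toReal := by
  have hm := (measurable_interDelivery 0).pow_const k
  rw [cycleMoment_eq_indicator, integral_indicator (measurableSet_delivery 0)]
  exact integral_toReal hm.aemeasurable (ae_lt_top hm h)

end PathSpace

section Renewal

variable {μ : Measure (ℕ → ℕ)} [IsProbabilityMeasure μ] {k : ℕ}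

lemma ae_frequently_delivery (hμ : Ergodic shift μ) (hpos : μ {y | y 0 = 1} ≠ 0) :
    ∀ᵐ y ∂μ, ∃ᶠ t in atTop, y t = 1 := by
  filter_upwards [ae_frequently_iterate_mem hμ (measurableSet_delivery 0) hpos] with y hy
  exact hy.mono fun n hn => by rwa [shift_iterate, zero_add] at hn

lemma ae_tendsto_sum_cycleMoment_div (hμ : Ergodic shift μ)
    (h : ∫⁻ y in {y | y 0 = 1}, (interDelivery y 0 : ℝ≥0∞) ^ k ∂μ ≠ ∞) :
    ∀ᵐ y ∂μ, Tendsto (fun n : ℕ => (∑ t ∈ Finset.range n, cycleMoment k y (t + 1)) / n) atTop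
      (𝓝 (∫⁻ y in {y | y 0 = 1}, (interDelivery y 0 : ℝ≥0∞) ^ k ∂μ).toReal) := by
  filter_upwards [hμ.quasiMeasurePreserving.ae
    (ae_tendsto_birkhoffAverage hμ (integrable_cycleMoment h))] with y hy
  rw [integral_cycleMoment h] at hy
  refine hy.congr fun n => ?_
  simp only [birkhoffAverage, birkhoffSum, ← Function.iterate_succ_apply,
    cycleMoment_shift_iterate, zero_add, smul_eq_mul, div_eq_inv_mul, Nat.succ_eq_add_one]

lemma ae_tendsto_sum_slotAge_pow_sub_div (hμ : Ergodic shift μ) (hpos : μ {y | y 0 = 1} ≠ 0)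
    (hk : k ≠ 0) (h : ∫⁻ y in {y | y 0 = 1}, (interDelivery y 0 : ℝ≥0∞) ^ k ∂μ ≠ ∞) :
    ∀ᵐ y ∂μ, Tendsto (fun n : ℕ =>
      (∑ t ∈ Finset.range n, (((slotAge y t : ℝ) + 1) ^ k - (slotAge y t : ℝ) ^ k)) / (n : ℝ))
      atTop (𝓝 (∫⁻ y in {y | y 0 = 1}, (interDelivery y 0 : ℝ≥0∞) ^ k ∂μ).toReal) := by
  filter_upwards [ae_frequently_delivery hμ hpos, ae_tendsto_sum_cycleMoment_div hμ h]
    with y hy hlim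
  exact tendsto_sum_slotAge_pow_sub_div hy hk hlim

/- Kac's formula: for `k = 1` the increments of `slotAge ^ k` are all equal to `1`. -/
lemma toReal_setLIntegral_interDelivery (hμ : Ergodic shift μ) (hpos : μ {y | y 0 = 1} ≠ 0)
    (h : ∫⁻ y in {y | y 0 = 1}, (interDelivery y 0 : ℝ≥0∞) ∂μ ≠ ∞) :
    (∫⁻ y in {y | y 0 = 1}, (interDelivery y 0 : ℝ≥0∞) ∂μ).toReal = 1 := by
  have hlim := ae_tendsto_sum_slotAge_pow_sub_div hμ hpos one_ne_zero (by simpa only [pow_one])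
  obtain ⟨y, hy⟩ := hlim.exists
  simp only [pow_one, add_sub_cancel_left, Finset.sum_const, Finset.card_range, nsmul_eq_mul,
    mul_one] at hy
  refine tendsto_nhds_unique (hy.congr' ?_) tendsto_const_nhds
  filter_upwards [eventually_gt_atTop 0] with n hn
  exact div_self (Nat.cast_ne_zero.2 hn.ne')

end Renewal

section StationarySequence

variable {Ω : Type*} [MeasurableSpace Ω] {P : Measure Ω}

lemma measure_mul_lintegral_cond [IsFiniteMeasure P] (s : Set Ω) (f : Ω → ℝ≥0∞) :
    P s * ∫⁻ ω, f ω ∂P[|s] = ∫⁻ ω in s, f ω ∂P := by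
  by_cases hs : P s = 0
  · rw [hs, zero_mul, Measure.restrict_eq_zero.2 hs, lintegral_zero_measure]
  · rw [ProbabilityTheory.cond, lintegral_smul_measure, smul_eq_mul,
      ENNReal.mul_inv_cancel_left hs (measure_ne_top P s)]

variable {Y : ℕ → Ω → ℕ}

lemma measure_mul_lintegral_interDelivery_pow_cond [IsFiniteMeasure P] (hYm : ∀ t, Measurable (Y t))
    (hY : MeasurePreserving shift (P.map fun ω r => Y r ω) (P.map fun ω r => Y r ω)) (k t : ℕ) :
    P {ω | Y t ω = 1} *
        ∫⁻ ω, (interDelivery (fun r => Y r ω) t : ℝ≥0∞) ^ k ∂P[|{ω | Y t ω = 1}] =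
      ∫⁻ y in {y | y 0 = 1}, (interDelivery y 0 : ℝ≥0∞) ^ k ∂P.map fun ω r => Y r ω := by
  rw [measure_mul_lintegral_cond, ← setLIntegral_interDelivery_pow hY k t,
    setLIntegral_map (measurableSet_delivery t) ((measurable_interDelivery t).pow_const k)
      (measurable_pi_lambda _ hYm)]
  rfl

lemma measure_delivery_eq (hYm : ∀ t, Measurable (Y t))
    (hY : MeasurePreserving shift (P.map fun ω r => Y r ω) (P.map fun ω r => Y r ω)) (t : ℕ) :
    (P.map fun ω r => Y r ω) {y | y 0 = 1} = P {ω | Y t ω = 1} := by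
  rw [← (hY.iterate t).measure_preimage
      (measurableSet_delivery 0).nullMeasurableSet,
    Measure.map_apply (measurable_pi_lambda _ hYm) (hY.measurable.iterate t
      (measurableSet_delivery 0))]
  congr 1
  ext ω
  change shift^[t] (fun r => Y r ω) 0 = 1 ↔ Y t ω = 1
  rw [shift_iterate, zero_add]

theorem ae_tendsto_average_fidelityAge [IsProbabilityMeasure P] {Δ : ℝ} (hΔ : 0 < Δ)
    (hYm : ∀ t, Measurable (Y t)) (hY : IsStationaryErgodic P Y) {t : ℕ}
    (hpos : P {ω | Y t ω = 1} ≠ 0)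
    (hfin : ∫⁻ ω, (interDelivery (fun r => Y r ω) t : ℝ≥0∞) ^ 2 ∂P[|{ω | Y t ω = 1}] ≠ ∞) :
    ∀ᵐ ω ∂P, Tendsto
      (fun T : ℝ => T⁻¹ * ∫ u in (0 : ℝ)..T, fidelityAge Δ (fun r => Y r ω) u) atTop
      (𝓝 (Δ * ((∫⁻ ω, (interDelivery (fun r => Y r ω) t : ℝ≥0∞) ^ 2
          ∂P[|{ω | Y t ω = 1}]).toReal /
        (2 * (∫⁻ ω, (interDelivery (fun r => Y r ω) t : ℝ≥0∞)
          ∂P[|{ω | Y t ω = 1}]).toReal)))) := by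
  have hpath : Measurable fun ω r => Y r ω := measurable_pi_lambda _ hYm
  have : IsProbabilityMeasure (P.map fun ω r => Y r ω) :=
    Measure.isProbabilityMeasure_map hpath.aemeasurable
  have hpos₀ := (measure_delivery_eq hYm hY.toMeasurePreserving t).trans_ne hpos
  have hmom (k : ℕ) :=
    measure_mul_lintegral_interDelivery_pow_cond hYm hY.toMeasurePreserving k t
  have hfin₂ := (hmom 2).symm.trans_ne (ENNReal.mul_ne_top (measure_ne_top P _) hfin)
  have hfin₁ : ∫⁻ y in {y | y 0 = 1}, (interDelivery y 0 : ℝ≥0∞) ∂(P.map fun ω r => Y r ω) ≠ ∞ :=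
    ne_top_of_le_ne_top hfin₂ (lintegral_mono fun y =>
      le_self_pow (one_le_interDelivery y 0) two_ne_zero)
  have hkac := toReal_setLIntegral_interDelivery hY hpos₀ hfin₁
  have hmom₁ := hmom 1
  simp only [pow_one] at hmom₁
  rw [← hmom₁, ENNReal.toReal_mul] at hkac
  have hlim := ae_of_ae_map hpath.aemeasurable
    (ae_tendsto_sum_slotAge_pow_sub_div hY hpos₀ two_ne_zero hfin₂)
  filter_upwards [hlim] with ω hω
  convert tendsto_average_fidelityAge hΔ hω using 3
  rw [← hmom 2, ENNReal.toReal_mul, eq_inv_of_mul_eq_one_left hkac]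
  field_simp

end StationarySequence

section Discrete

lemma pairwise_disjoint_preimage_singleton {Ω β ι : Type*} (X : Ω → β) {a : ι → β}
    (ha : Function.Injective a) : Pairwise (Function.onFun Disjoint fun i => X ⁻¹' {a i}) :=
  fun _ _ hij => Disjoint.preimage X (Set.disjoint_singleton.2 (ha.ne hij))

variable {Ω β ι : Type*} [MeasurableSpace Ω] [MeasurableSpace β] [MeasurableSingletonClass β]
  [Countable ι] {μ : Measure Ω} {X : Ω → β} {a : ι → β}

lemma ae_mem_range_of_tsum_eq [IsFiniteMeasure μ] (hX : Measurable X) (ha : Function.Injective a)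
    (h : ∑' i, μ (X ⁻¹' {a i}) = μ Set.univ) : ∀ᵐ ω ∂μ, X ω ∈ Set.range a := by
  have hm (i : ι) : MeasurableSet (X ⁻¹' {a i}) := hX (measurableSet_singleton _)
  have hrange : X ⁻¹' Set.range a = ⋃ i, X ⁻¹' {a i} := by
    rw [← Set.iUnion_singleton_eq_range, Set.preimage_iUnion]
  change X ⁻¹' Set.range a ∈ ae μ
  rwa [hrange, ← eventuallyEq_univ,
    ae_eq_univ_iff_measure_eq (MeasurableSet.iUnion hm).nullMeasurableSet,
    measure_iUnion (pairwise_disjoint_preimage_singleton X ha) hm]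

lemma lintegral_comp_eq_tsum (hX : Measurable X) (ha : Function.Injective a)
    (h : ∀ᵐ ω ∂μ, X ω ∈ Set.range a) (f : β → ℝ≥0∞) :
    ∫⁻ ω, f (X ω) ∂μ = ∑' i, f (a i) * μ (X ⁻¹' {a i}) := by
  have hm (i : ι) : MeasurableSet (X ⁻¹' {a i}) := hX (measurableSet_singleton _)
  have huniv : (⋃ i, X ⁻¹' {a i} : Set Ω) =ᵐ[μ] Set.univ := by
    rw [← Set.preimage_iUnion, Set.iUnion_singleton_eq_range]
    exact eventuallyEq_univ.2 h
  rw [← setLIntegral_univ, ← setLIntegral_congr huniv,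
    lintegral_iUnion hm (pairwise_disjoint_preimage_singleton X ha)]
  refine tsum_congr fun i => ?_
  rw [setLIntegral_congr_fun (hm i) fun ω (hω : X ω = a i) => congrArg f hω, setLIntegral_const]

end Discrete

section Geometric

variable {p : ℝ}

lemma hasSum_geometric_mul (hp : 0 < p) (hp1 : p ≤ 1) :
    HasSum (fun k : ℕ => (1 - p) ^ k * p) 1 := by
  have h := (hasSum_geometric_of_lt_one (sub_nonneg.2 hp1) (sub_lt_self 1 hp)).mul_right p
  rwa [sub_sub_cancel, inv_mul_cancel₀ hp.ne'] at h

lemma norm_one_sub_lt_one (hp : 0 < p) (hp1 : p ≤ 1) : ‖1 - p‖ < 1 := by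
  rw [Real.norm_of_nonneg (sub_nonneg.2 hp1)]
  exact sub_lt_self 1 hp

lemma hasSum_succ_mul_geometric (hp : 0 < p) (hp1 : p ≤ 1) :
    HasSum (fun k : ℕ => ((k + 1 : ℕ) : ℝ) * ((1 - p) ^ k * p)) (1 / p) := by
  have h := (hasSum_choose_mul_geometric_of_norm_lt_one 1 (norm_one_sub_lt_one hp hp1)).mul_right p
  have hval : 1 / (1 - (1 - p)) ^ (1 + 1) * p = 1 / p := by
    rw [sub_sub_cancel]
    field_simp
  have hterm (k : ℕ) : ((k + 1).choose 1 : ℝ) * (1 - p) ^ k * p =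
      ((k + 1 : ℕ) : ℝ) * ((1 - p) ^ k * p) := by
    rw [Nat.choose_one_right, mul_assoc]
  rwa [hval, funext hterm] at h

lemma hasSum_succ_sq_mul_geometric (hp : 0 < p) (hp1 : p ≤ 1) :
    HasSum (fun k : ℕ => ((k + 1 : ℕ) : ℝ) ^ 2 * ((1 - p) ^ k * p)) ((2 - p) / p ^ 2) := by
  -- `(k + 1) ^ 2 = 2 * (k + 2).choose 2 - (k + 1)`
  have h := ((hasSum_choose_mul_geometric_of_norm_lt_one 2
    (norm_one_sub_lt_one hp hp1)).mul_right (2 * p)).sub (hasSum_succ_mul_geometric hp hp1)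
  have hval : 1 / (1 - (1 - p)) ^ (2 + 1) * (2 * p) - 1 / p = (2 - p) / p ^ 2 := by
    rw [sub_sub_cancel]
    field_simp
    ring
  have hterm (k : ℕ) : ((k + 2).choose 2 : ℝ) * (1 - p) ^ k * (2 * p) -
      ((k + 1 : ℕ) : ℝ) * ((1 - p) ^ k * p) = ((k + 1 : ℕ) : ℝ) ^ 2 * ((1 - p) ^ k * p) := by
    rw [Nat.cast_choose_two]
    push_cast
    ring
  rwa [hval, funext hterm] at h

lemma lintegral_pow_of_geometric {Ω : Type*} [MeasurableSpace Ω] {μ : Measure Ω}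
    [IsProbabilityMeasure μ] {τ : Ω → ℝ≥0∞} (hτ : Measurable τ) (hp : 0 < p) (hp1 : p ≤ 1)
    (hgeom : ∀ k : ℕ, μ {ω | τ ω = ((k + 1 : ℕ) : ℝ≥0∞)} = ENNReal.ofReal ((1 - p) ^ k * p))
    {j : ℕ} {c : ℝ} (hc : HasSum (fun k : ℕ => ((k + 1 : ℕ) : ℝ) ^ j * ((1 - p) ^ k * p)) c) :
    ∫⁻ ω, τ ω ^ j ∂μ = ENNReal.ofReal c := by
  have hnonneg (k : ℕ) : 0 ≤ (1 - p) ^ k * p := by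
    have := sub_nonneg.2 hp1
    positivity
  have hlaw (k : ℕ) : μ (τ ⁻¹' {((k + 1 : ℕ) : ℝ≥0∞)}) = ENNReal.ofReal ((1 - p) ^ k * p) :=
    hgeom k
  have hinj : Function.Injective fun k : ℕ => ((k + 1 : ℕ) : ℝ≥0∞) :=
    Nat.cast_injective.comp Nat.succ_injective
  have hrange := ae_mem_range_of_tsum_eq hτ hinj (μ := μ) <| by
    have hsum := hasSum_geometric_mul hp hp1
    simp only [hlaw]
    rw [← ENNReal.ofReal_tsum_of_nonneg hnonneg hsum.summable, hsum.tsum_eq, ENNReal.ofReal_one,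
      measure_univ]
  rw [lintegral_comp_eq_tsum hτ hinj hrange fun x => x ^ j, ← hc.tsum_eq,
    ENNReal.ofReal_tsum_of_nonneg (fun k => mul_nonneg (by positivity) (hnonneg k)) hc.summable]
  refine tsum_congr fun k => ?_
  rw [hlaw, ENNReal.ofReal_mul (p := ((k + 1 : ℕ) : ℝ) ^ j) (by positivity),
    ENNReal.ofReal_pow (by positivity), ENNReal.ofReal_natCast]

end Geometric

section Independence

variable {Ω β γ : Type*} [MeasurableSpace Ω] [MeasurableSpace β] [MeasurableSpace γ]
  {f : Ω → β} {g : Ω → γ}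

lemma indepFun_fst_prodMk_comp_snd {S : Type*} [MeasurableSpace S] {μ : Measure S}
    [IsProbabilityMeasure μ] {ρ : Measure Ω} [IsProbabilityMeasure ρ] (hf : Measurable f)
    (hg : Measurable g) (h : IndepFun f g ρ) :
    IndepFun (fun p : S × Ω => (p.1, f p.2)) (fun p => g p.2) (μ.prod ρ) := by
  have := Measure.isProbabilityMeasure_map (μ := ρ) hf.aemeasurable
  have := Measure.isProbabilityMeasure_map (μ := ρ) hg.aemeasurable
  have hleft : (μ.prod ρ).map (fun p => (p.1, f p.2)) = μ.prod (ρ.map f) := by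
    have h := Measure.map_prod_map μ ρ measurable_id hf
    rw [Measure.map_id] at h
    exact h.symm
  have hright : (μ.prod ρ).map (fun p => g p.2) = ρ.map g := by
    rw [← Function.comp_def, ← Measure.map_map hg measurable_snd, Measure.map_snd_prod,
      measure_univ, one_smul]
  have hjoint : (μ.prod ρ).map (fun p => (p.1, f p.2, g p.2)) =
      μ.prod ((ρ.map f).prod (ρ.map g)) := by
    have h' := Measure.map_prod_map μ ρ measurable_id (hf.prodMk hg)
    rw [Measure.map_id] at h'
    rw [← (indepFun_iff_map_prod_eq_prod_map_map hf.aemeasurable hg.aemeasurable).1 h, h']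
    rfl
  rw [indepFun_iff_map_prod_eq_prod_map_map (by fun_prop) (by fun_prop), hleft, hright,
    ← (measurePreserving_prodAssoc μ (ρ.map f) (ρ.map g)).symm.map_eq, ← hjoint,
    Measure.map_map (MeasurableEquiv.measurable _) (by fun_prop)]
  rfl

lemma condExp_indicator_preimage_prodMk {P : Measure Ω} [IsProbabilityMeasure P]
    (hf : Measurable f) (hg : Measurable g) (h : IndepFun f g P) {E : Set (β × γ)}
    (hE : MeasurableSet E) :
    (fun ω => (P.map g).real (Prod.mk (f ω) ⁻¹' E)) =ᵐ[P]
      P[((fun ω => (f ω, g ω)) ⁻¹' E).indicator fun _ => (1 : ℝ) |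
        MeasurableSpace.comap f inferInstance] := by
  have := Measure.isProbabilityMeasure_map (μ := P) hf.aemeasurable
  have := Measure.isProbabilityMeasure_map (μ := P) hg.aemeasurable
  have hfg := hf.prodMk hg
  have hsection : Measurable fun b => (P.map g).real (Prod.mk b ⁻¹' E) :=
    (measurable_measure_prodMk_left hE).ennreal_toReal
  have hint : Integrable (fun ω => (P.map g).real (Prod.mk (f ω) ⁻¹' E)) P :=
    Integrable.of_bound (hsection.comp hf).aestronglyMeasurable 1
      (ae_of_all _ fun _ => by
        rw [Real.norm_of_nonneg measureReal_nonneg]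
        exact measureReal_le_one)
  refine ae_eq_condExp_of_forall_setIntegral_eq hf.comap_le
    ((integrable_const 1).indicator (hfg hE)) (fun _ _ _ => hint.integrableOn) ?_
    (hsection.comp (comap_measurable f)).aestronglyMeasurable
  rintro _ ⟨B, hB, rfl⟩ -
  have hBuniv : MeasurableSet (B ×ˢ (Set.univ : Set γ)) := hB.prod MeasurableSet.univ
  calc ∫ ω in f ⁻¹' B, (P.map g).real (Prod.mk (f ω) ⁻¹' E) ∂P
      = ∫ b in B, (P.map g).real (Prod.mk b ⁻¹' E) ∂P.map f :=
        (setIntegral_map hB hsection.aestronglyMeasurable hf.aemeasurable).symm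
    _ = ∫ b in B, ∫ c in Set.univ, E.indicator (fun _ => 1) (b, c) ∂P.map g ∂P.map f := by
        refine integral_congr_ae (ae_of_all _ fun b => ?_)
        beta_reduce
        rw [setIntegral_univ]
        exact (integral_indicator_one (measurable_prodMk_left hE)).symm
    _ = ∫ q in B ×ˢ Set.univ, E.indicator (fun _ => 1) q ∂P.map fun ω => (f ω, g ω) := by
        rw [(indepFun_iff_map_prod_eq_prod_map_map hf.aemeasurable hg.aemeasurable).1 h,
          setIntegral_prod _ ((integrable_const (1 : ℝ)).indicator hE).integrableOn]
    _ = ∫ ω in (fun ω => (f ω, g ω)) ⁻¹' (B ×ˢ Set.univ), E.indicator (fun _ => 1) (f ω, g ω) ∂P :=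
        setIntegral_map hBuniv (stronglyMeasurable_const.indicator hE).aestronglyMeasurable
          hfg.aemeasurable
    _ = ∫ ω in f ⁻¹' B, ((fun ω => (f ω, g ω)) ⁻¹' E).indicator (fun _ => 1) ω ∂P := by
        rw [Set.mk_preimage_prod, Set.preimage_univ, Set.inter_univ]
        rfl

end Independence

section ZeroOne

lemma ae_eq_const_of_tendsto_comp_iterate {α : Type*} [MeasurableSpace α] {μ : Measure α}
    [IsFiniteMeasure μ] {T : α → α} (hT : MeasurePreserving T μ μ) {g : α → ℝ} (hg : Measurable g)
    {c : ℝ} (h : ∀ᵐ x ∂μ, Tendsto (fun n => g (T^[n] x)) atTop (𝓝 c)) : ∀ᵐ x ∂μ, g x = c := by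
  have hlim := tendstoInMeasure_of_tendsto_ae
    (fun n => (hg.comp (hT.iterate n).measurable).aestronglyMeasurable) h
  have hfar (k : ℕ) : μ {x | ENNReal.ofReal (1 / (k + 1)) ≤ edist (g x) c} = 0 := by
    have hconst (n : ℕ) : μ {x | ENNReal.ofReal (1 / (k + 1)) ≤ edist (g (T^[n] x)) c} =
        μ {x | ENNReal.ofReal (1 / (k + 1)) ≤ edist (g x) c} :=
      (hT.iterate n).measure_preimage
        (measurableSet_le measurable_const (hg.edist measurable_const)).nullMeasurableSet
    have hk := hlim (ENNReal.ofReal (1 / (k + 1))) (ENNReal.ofReal_pos.2 Nat.one_div_pos_of_nat)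
    simp only [Function.comp_apply, hconst] at hk
    exact tendsto_nhds_unique tendsto_const_nhds hk
  filter_upwards [ae_all_iff.2 fun k => measure_eq_zero_iff_ae_notMem.1 (hfar k)] with x hx
  by_contra hne
  obtain ⟨k, hk⟩ := exists_nat_one_div_lt (dist_pos.2 hne)
  exact hx k (by rw [edist_dist]; exact ENNReal.ofReal_le_ofReal hk.le)

lemma ae_eq_preimage_fst_of_section_zero_or_one {S Y : Type*} [MeasurableSpace S]
    [MeasurableSpace Y] {μ : Measure S} [SFinite μ] {ρ : Measure Y} [IsProbabilityMeasure ρ]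
    {E : Set (S × Y)} (hE : MeasurableSet E)
    (h : ∀ᵐ s ∂μ, ρ (Prod.mk s ⁻¹' E) = 0 ∨ ρ (Prod.mk s ⁻¹' E) = 1) :
    E =ᵐ[μ.prod ρ] Prod.fst ⁻¹' {s | ρ (Prod.mk s ⁻¹' E) = 1} := by
  have hA : MeasurableSet {s | ρ (Prod.mk s ⁻¹' E) = 1} :=
    measurable_measure_prodMk_left hE (measurableSet_singleton 1)
  rw [eventuallyEq_set]
  refine (Measure.ae_prod_iff_ae_ae ?_).2 ?_
  · exact measurableSet_setOfPred.2 ((measurableSet_setOfPred.1 hE).iff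
      (measurableSet_setOfPred.1 (measurable_fst hA)))
  filter_upwards [h] with s hs
  rcases hs with hs | hs
  · filter_upwards [measure_eq_zero_iff_ae_notMem.1 hs] with y hy
    simpa [hs] using hy
  · have := (prob_compl_eq_zero_iff (measurable_prodMk_left hE)).2 hs
    filter_upwards [measure_eq_zero_iff_ae_notMem.1 this] with y hy
    simpa [hs] using hy

end ZeroOne

section DrivenSystem

lemma measurable_shift {S : Type*} [MeasurableSpace S] : Measurable (shift : (ℕ → S) → ℕ → S) :=
  measurable_pi_lambda _ fun _ => measurable_pi_apply _

variable {S X : Type*}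

/-- The first `n` terms of a sequence. -/
def initialTerms (n : ℕ) (x : ℕ → X) (i : Fin n) : X := x i

/-- The initial state and the first `n` inputs of a driven system. -/
def past (n : ℕ) (p : S × (ℕ → X)) : S × (Fin n → X) := (p.1, initialTerms n p.2)

/-- One step of a system with states in `S` that is driven by a sequence of inputs in `X` through
the update rule `F`: the first input is consumed. -/
def skewShift (F : S × X → S) (p : S × (ℕ → X)) : S × (ℕ → X) := (F (p.1, p.2 0), shift p.2)

/-- The state of the system with update rule `F`, as a function of the initial state and the first
`n` inputs. -/
def stateAfter (F : S × X → S) : (n : ℕ) → S × (Fin n → X) → S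
  | 0, q => q.1
  | n + 1, q => F (stateAfter F n (q.1, Fin.init q.2), q.2 (Fin.last n))

lemma skewShift_iterate (F : S × X → S) (n : ℕ) (p : S × (ℕ → X)) :
    (skewShift F)^[n] p = (stateAfter F n (past n p), shift^[n] p.2) := by
  induction n with
  | zero => rfl
  | succ n ih =>
    have hinput : (stateAfter F n (past n p), shift^[n] p.2).2 0 = p.2 n := by
      change shift^[n] p.2 0 = p.2 n
      rw [shift_iterate, zero_add]
    rw [Function.iterate_succ_apply', ih, Function.iterate_succ_apply', skewShift, hinput]
    rfl

lemma preimage_stateAfter_of_invariant {F : S × X → S} {E : Set (S × (ℕ → X))}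
    (hinv : skewShift F ⁻¹' E = E) (n : ℕ) :
    (fun p => (past n p, shift^[n] p.2)) ⁻¹' ((fun q => (stateAfter F n q.1, q.2)) ⁻¹' E) = E := by
  have hiter := Function.IsFixedPt.iterate (f := Set.preimage (skewShift F)) hinv n
  rw [← Set.preimage_iterate_eq] at hiter
  conv_rhs => rw [← hiter, Set.preimage, funext (skewShift_iterate F n)]
  rfl

variable [MeasurableSpace S] [MeasurableSpace X]

lemma measurable_initialTerms (n : ℕ) : Measurable (initialTerms n : (ℕ → X) → Fin n → X) :=
  measurable_pi_lambda _ fun _ => measurable_pi_apply _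

lemma measurable_past (n : ℕ) : Measurable (past n : S × (ℕ → X) → S × (Fin n → X)) :=
  measurable_fst.prodMk ((measurable_initialTerms n).comp measurable_snd)

lemma measurable_skewShift {F : S × X → S} (hF : Measurable F) : Measurable (skewShift F) :=
  (hF.comp (measurable_fst.prodMk ((measurable_pi_apply 0).comp measurable_snd))).prodMk
    (measurable_shift.comp measurable_snd)

lemma measurable_stateAfter {F : S × X → S} (hF : Measurable F) (n : ℕ) :
    Measurable (stateAfter F n) := by
  induction n with
  | zero => exact measurable_fst
  | succ n ih =>
    have hinit : Measurable fun q : S × (Fin (n + 1) → X) => (q.1, Fin.init q.2) :=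
      measurable_fst.prodMk
        (measurable_pi_lambda _ fun i => (measurable_pi_apply i.castSucc).comp measurable_snd)
    exact hF.comp ((ih.comp hinit).prodMk ((measurable_pi_apply _).comp measurable_snd))

/-- The information in the initial state and the first `n` inputs. -/
def inputFiltration (S X : Type*) [MeasurableSpace S] [MeasurableSpace X] :
    Filtration ℕ (inferInstance : MeasurableSpace (S × (ℕ → X))) where
  seq n := MeasurableSpace.comap (past n) inferInstance
  mono' m n hmn := by
    have h : Measurable fun q : S × (Fin n → X) => (q.1, fun i : Fin m => q.2 (Fin.castLE hmn i)) :=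
      measurable_fst.prodMk
        (measurable_pi_lambda _ fun i => (measurable_pi_apply _).comp measurable_snd)
    exact (h.comp (comap_measurable (past n))).comap_le
  le' n := (measurable_past n).comap_le

lemma iSup_inputFiltration :
    ⨆ n, inputFiltration S X n = (inferInstance : MeasurableSpace (S × (ℕ → X))) := by
  have hpast (n : ℕ) : Measurable[inputFiltration S X n] (past n : S × (ℕ → X) → _) :=
    comap_measurable _
  have hfst : Measurable[inputFiltration S X 0] (Prod.fst : S × (ℕ → X) → S) :=
    (measurable_fst (α := S) (β := Fin 0 → X)).comp (hpast 0)
  have hinput (i : ℕ) : Measurable[inputFiltration S X (i + 1)] fun p : S × (ℕ → X) => p.2 i :=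
    ((measurable_pi_apply (Fin.last i)).comp measurable_snd).comp (hpast (i + 1))
  refine le_antisymm (iSup_le fun n => (inputFiltration S X).le n) (sup_le ?_ ?_)
  · exact (hfst.mono (le_iSup _ 0) le_rfl).comap_le
  · refine Measurable.comap_le ?_
    exact @measurable_pi_lambda _ _ _ (_) _ _ fun i => (hinput i).mono (le_iSup _ (i + 1)) le_rfl

end DrivenSystem

section IidInputs

variable {S X : Type*} [MeasurableSpace S] [MeasurableSpace X]

/-- The law of an initial state and an independent i.i.d. sequence of inputs. -/
noncomputable abbrev inputLaw (μ : Measure S) (ν : Measure X) : Measure (S × (ℕ → X)) :=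
  μ.prod (Measure.infinitePi fun _ : ℕ => ν)

/-- The probability of the event `E` when the system starts in the state `s` and is driven by i.i.d.
inputs of law `ν`. -/
noncomputable def sectionProb (ν : Measure X) (E : Set (S × (ℕ → X)))
    (s : S) : ℝ :=
  (Measure.infinitePi fun _ : ℕ => ν).real (Prod.mk s ⁻¹' E)

variable (μ : Measure S) [IsProbabilityMeasure μ] (ν : Measure X) [IsProbabilityMeasure ν]

lemma map_shift_iterate_infinitePi (n : ℕ) :
    (Measure.infinitePi fun _ : ℕ => ν).map shift^[n] = Measure.infinitePi fun _ : ℕ => ν := by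
  rw [show (shift^[n] : (ℕ → X) → ℕ → X) = fun x t => x (t + n) from
    funext₂ (shift_iterate n)]
  exact Measure.map_infinitePi_infinitePi_of_inj (P := fun _ : ℕ => ν) (add_left_injective n)

lemma indepFun_initialTerms_shift_iterate (n : ℕ) :
    IndepFun (initialTerms n) shift^[n] (Measure.infinitePi fun _ : ℕ => ν) := by
  have hind : iIndep (fun i : ℕ => MeasurableSpace.comap (fun x : ℕ → X => x i) inferInstance)
      (Measure.infinitePi fun _ : ℕ => ν) :=
    iIndepFun_infinitePi (P := fun _ : ℕ => ν) (X := fun _ x => x) fun _ => measurable_id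
  have hdisj : Disjoint (Set.Iio n) (Set.Ici n) := Set.Iio_disjoint_Ici le_rfl
  refine indep_of_indep_of_le_left (indep_of_indep_of_le_right
    (indep_iSup_of_disjoint (fun i => (measurable_pi_apply i).comap_le) hind hdisj) ?_) ?_
  · refine Measurable.comap_le (@measurable_pi_lambda _ _ _ (_) _ _ fun t => ?_)
    simp only [shift_iterate]
    exact (comap_measurable fun x : ℕ → X => x (t + n)).mono
      (le_iSup₂_of_le (t + n) (Nat.le_add_left n t) le_rfl) le_rfl
  · refine Measurable.comap_le (@measurable_pi_lambda _ _ _ (_) _ _ fun i => ?_)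
    exact (comap_measurable fun x : ℕ → X => x i).mono
      (le_iSup₂_of_le (i : ℕ) i.2 le_rfl) le_rfl

lemma map_shift_iterate_snd_inputLaw (n : ℕ) :
    (inputLaw μ ν).map (fun p => shift^[n] p.2) = Measure.infinitePi fun _ : ℕ => ν := by
  rw [← Function.comp_def, ← Measure.map_map (measurable_shift.iterate n) measurable_snd,
    Measure.map_snd_prod, measure_univ, one_smul, map_shift_iterate_infinitePi]

lemma indepFun_past_shift_iterate (n : ℕ) :
    IndepFun (past n) (fun p => shift^[n] p.2) (inputLaw μ ν) :=
  indepFun_fst_prodMk_comp_snd (measurable_initialTerms n) (measurable_shift.iterate n)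
    (indepFun_initialTerms_shift_iterate ν n)

variable {μ ν} {F : S × X → S} {E : Set (S × (ℕ → X))}

lemma measurePreserving_skewShift (hF : Measurable F)
    (hμ : (inputLaw μ ν).map (fun p => (skewShift F p).1) = μ) :
    MeasurePreserving (skewShift F) (inputLaw μ ν) (inputLaw μ ν) := by
  have hind : IndepFun (fun p => (skewShift F p).1) (fun p => (skewShift F p).2) (inputLaw μ ν) :=
    (indepFun_past_shift_iterate μ ν 1).comp (measurable_stateAfter hF 1) measurable_id
  have hT := measurable_skewShift (X := X) hF
  refine ⟨hT, ?_⟩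
  have h := (indepFun_iff_map_prod_eq_prod_map_map hT.fst.aemeasurable hT.snd.aemeasurable).1 hind
  rw [hμ] at h
  exact h.trans (congrArg _ (map_shift_iterate_snd_inputLaw μ ν 1))

lemma measurable_sectionProb (hE : MeasurableSet E) : Measurable (sectionProb ν E) :=
  (measurable_measure_prodMk_left hE).ennreal_toReal

lemma condExp_indicator_of_invariant (hF : Measurable F) (hE : MeasurableSet E)
    (hinv : skewShift F ⁻¹' E = E) (n : ℕ) :
    (fun p => sectionProb ν E ((skewShift F)^[n] p).1) =ᵐ[inputLaw μ ν]
      (inputLaw μ ν)[E.indicator fun _ => (1 : ℝ) | inputFiltration S X n] := by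
  have hE' : MeasurableSet ((fun q : (S × (Fin n → X)) × (ℕ → X) =>
      (stateAfter F n q.1, q.2)) ⁻¹' E) :=
    (((measurable_stateAfter hF n).comp measurable_fst).prodMk measurable_snd) hE
  have hlater : Measurable fun p : S × (ℕ → X) => shift^[n] p.2 :=
    (measurable_shift.iterate n).comp measurable_snd
  have h := condExp_indicator_preimage_prodMk (measurable_past n) hlater
    (indepFun_past_shift_iterate μ ν n) hE'
  rw [preimage_stateAfter_of_invariant hinv n, map_shift_iterate_snd_inputLaw] at h
  simp only [skewShift_iterate]
  exact h

lemma ae_tendsto_sectionProb_of_invariant (hF : Measurable F) (hE : MeasurableSet E)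
    (hinv : skewShift F ⁻¹' E = E) :
    ∀ᵐ p ∂inputLaw μ ν, Tendsto (fun n => sectionProb ν E ((skewShift F)^[n] p).1) atTop
      (𝓝 (E.indicator (fun _ => (1 : ℝ)) p)) := by
  have hlevy := tendsto_ae_condExp (μ := inputLaw μ ν) (ℱ := inputFiltration S X)
    (E.indicator fun _ => (1 : ℝ))
  rw [iSup_inputFiltration, condExp_of_stronglyMeasurable le_rfl
    (stronglyMeasurable_const.indicator hE) ((integrable_const (1 : ℝ)).indicator hE)] at hlevy
  filter_upwards [ae_all_iff.2 (condExp_indicator_of_invariant (μ := μ) (ν := ν) hF hE hinv), hlevy]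
    with p hcond hlim
  exact hlim.congr fun n => (hcond n).symm

lemma ae_sectionProb_eq_zero_or_one (hF : Measurable F)
    (hT : MeasurePreserving (skewShift F) (inputLaw μ ν) (inputLaw μ ν)) (hE : MeasurableSet E)
    (hinv : skewShift F ⁻¹' E = E) : ∀ᵐ s ∂μ, sectionProb ν E s = 0 ∨ sectionProb ν E s = 1 := by
  have hm : Measurable fun s => sectionProb ν E s * (1 - sectionProb ν E s) :=
    (measurable_sectionProb hE).mul (measurable_const.sub (measurable_sectionProb hE))
  have hlim : ∀ᵐ p ∂inputLaw μ ν, Tendsto (fun n => sectionProb ν E ((skewShift F)^[n] p).1 *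
      (1 - sectionProb ν E ((skewShift F)^[n] p).1)) atTop (𝓝 0) := by
    filter_upwards [ae_tendsto_sectionProb_of_invariant hF hE hinv] with p hp
    have hp' := hp.mul (hp.const_sub 1)
    by_cases hpE : p ∈ E <;> simpa [hpE] using hp'
  have hzero := ae_eq_const_of_tendsto_comp_iterate hT (hm.comp measurable_fst) hlim
  rw [← Measure.fst_prod (μ := μ) (ν := Measure.infinitePi fun _ : ℕ => ν)]
  filter_upwards [(ae_map_iff measurable_fst.aemeasurable
    (measurableSet_eq_fun hm measurable_const)).2 hzero] with s hs
  exact (mul_eq_zero.1 hs).imp_right fun h => (sub_eq_zero.1 h).symm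

lemma exists_ae_eq_preimage_fst_of_invariant (hF : Measurable F)
    (hT : MeasurePreserving (skewShift F) (inputLaw μ ν) (inputLaw μ ν)) (hE : MeasurableSet E)
    (hinv : skewShift F ⁻¹' E = E) :
    ∃ A : Set S, MeasurableSet A ∧ E =ᵐ[inputLaw μ ν] Prod.fst ⁻¹' A := by
  refine ⟨_, measurable_measure_prodMk_left hE (measurableSet_singleton 1),
    ae_eq_preimage_fst_of_section_zero_or_one hE ?_⟩
  filter_upwards [ae_sectionProb_eq_zero_or_one hF hT hE hinv] with s hs
  exact hs.imp (measureReal_eq_zero_iff (measure_ne_top _ _)).1 (ENNReal.toReal_eq_one_iff _).1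

end IidInputs

section Factors

variable {α S : Type*} [MeasurableSpace α] [MeasurableSpace S] {M : Measure α}

lemma isStationaryErgodic_of_ergodic {T : α → α} (hT : Ergodic T M) {g : α → S}
    (hg : Measurable g) : IsStationaryErgodic M fun t p => g (T^[t] p) := by
  have hm : Measurable fun (p : α) (t : ℕ) => g (T^[t] p) :=
    measurable_pi_lambda _ fun t => hg.comp (hT.measurable.iterate t)
  exact MeasurePreserving.ergodic_of_ergodic_semiconj ⟨hm, rfl⟩ hT measurable_shift fun p => rfl

lemma isStationaryErgodic_map {Z : Type*} [MeasurableSpace Z] {W : ℕ → α → Z}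
    (hW : ∀ t, Measurable (W t)) (h : IsStationaryErgodic M W) {g : Z → S} (hg : Measurable g) :
    IsStationaryErgodic M fun t p => g (W t p) := by
  have hgm : Measurable fun (z : ℕ → Z) (t : ℕ) => g (z t) :=
    measurable_pi_lambda _ fun t => hg.comp (measurable_pi_apply t)
  have hm : Measurable fun (p : α) (t : ℕ) => W t p := measurable_pi_lambda _ hW
  refine MeasurePreserving.ergodic_of_ergodic_semiconj ⟨hgm, ?_⟩ h measurable_shift fun z => rfl
  rw [Measure.map_map hgm hm]
  rfl

lemma isStationaryErgodic_comp_iff {Ω : Type*} [MeasurableSpace Ω] {P : Measure Ω} {q : Ω → α}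
    (hq : MeasurePreserving q P M) {W : ℕ → α → S} (hW : ∀ t, Measurable (W t)) :
    IsStationaryErgodic P (fun t ω => W t (q ω)) ↔ IsStationaryErgodic M W := by
  have hm : Measurable fun (p : α) (t : ℕ) => W t p := measurable_pi_lambda _ hW
  unfold IsStationaryErgodic
  rw [← hq.map_eq, Measure.map_map hm hq.measurable]
  rfl

end Factors

section DrivenErgodicity

variable {S X : Type*} [MeasurableSpace S] [MeasurableSpace X] {μ : Measure S}
  [IsProbabilityMeasure μ] {ν : Measure X} [IsProbabilityMeasure ν] {F : S × X → S}

lemma eventuallyConst_of_isStationaryErgodic {α : Type*} [MeasurableSpace α] {M : Measure α}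
    {W : ℕ → α → S} (hW : ∀ t, Measurable (W t)) (h : IsStationaryErgodic M W) {A : Set S}
    (hA : MeasurableSet A) (hinv : W 1 ⁻¹' A =ᵐ[M] W 0 ⁻¹' A) :
    EventuallyConst (W 0 ⁻¹' A) (ae M) := by
  set path : α → ℕ → S := fun p t => W t p
  have hpath : MeasurePreserving path M (M.map path) := ⟨measurable_pi_lambda _ hW, rfl⟩
  set B : Set (ℕ → S) := (fun z => z 0) ⁻¹' A
  have hB : MeasurableSet B := measurable_pi_apply 0 hA
  have hBinv : shift ⁻¹' B =ᵐ[M.map path] B := by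
    rw [ae_eq_set] at hinv ⊢
    rwa [← hpath.measure_preimage ((measurable_shift hB).diff hB).nullMeasurableSet,
      ← hpath.measure_preimage (hB.diff (measurable_shift hB)).nullMeasurableSet]
  rw [eventuallyConst_set']
  exact (h.quasiErgodic.ae_empty_or_univ₀ hB.nullMeasurableSet hBinv).imp
    hpath.quasiMeasurePreserving.preimage_ae_eq hpath.quasiMeasurePreserving.preimage_ae_eq

lemma map_one_eq_map_zero_of_measurePreserving_shift {α : Type*} [MeasurableSpace α]
    {M : Measure α} {W : ℕ → α → S} (hW : ∀ t, Measurable (W t))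
    (h : MeasurePreserving shift (M.map fun p t => W t p) (M.map fun p t => W t p)) :
    M.map (W 1) = M.map (W 0) := by
  have hpath : Measurable fun p t => W t p := measurable_pi_lambda _ hW
  have h0 := congrArg (Measure.map fun z : ℕ → S => z 0) h.map_eq
  rwa [Measure.map_map (measurable_pi_apply 0) measurable_shift, Measure.map_map
    ((measurable_pi_apply 0).comp measurable_shift) hpath,
    Measure.map_map (measurable_pi_apply 0) hpath] at h0

theorem ergodic_skewShift (hF : Measurable F)
    (hS : IsStationaryErgodic (inputLaw μ ν) fun t p => ((skewShift F)^[t] p).1) :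
    Ergodic (skewShift F) (inputLaw μ ν) := by
  have hstate (t : ℕ) : Measurable fun p : S × (ℕ → X) => ((skewShift F)^[t] p).1 :=
    measurable_fst.comp ((measurable_skewShift hF).iterate t)
  have hT : MeasurePreserving (skewShift F) (inputLaw μ ν) (inputLaw μ ν) :=
    measurePreserving_skewShift hF ((map_one_eq_map_zero_of_measurePreserving_shift hstate
      hS.toMeasurePreserving).trans Measure.fst_prod)
  refine ⟨hT, ⟨fun E hE hinv => ?_⟩⟩
  obtain ⟨A, hA, hEA⟩ := exists_ae_eq_preimage_fst_of_invariant hF hT hE hinv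
  have hEA' := hT.quasiMeasurePreserving.preimage_ae_eq hEA
  rw [hinv] at hEA'
  exact (eventuallyConst_of_isStationaryErgodic hstate hS hA (hEA'.symm.trans hEA)).congr hEA.symm

end DrivenErgodicity

section OptionMeasurability

variable {α β γ : Type*} [MeasurableSpace α] [MeasurableSpace β] [MeasurableSpace γ]

lemma measurable_some : Measurable (some : α → Option α) := fun _ hs => hs

lemma measurable_of_comp_some {f : Option α → β} (hf : Measurable (f ∘ some)) : Measurable f :=
  fun _ hs => hf hs

lemma measurableSet_isSome {f : γ → Option α} (hf : Measurable f) :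
    MeasurableSet {c | (f c).isSome} :=
  (measurable_of_comp_some measurable_const : Measurable (Option.isSome : Option α → Bool)).comp hf
    (measurableSet_singleton true)

lemma measurable_option_bind {f : γ → Option α} {g : γ → α → Option β} (hf : Measurable f)
    (hg : Measurable (Function.uncurry g)) : Measurable fun c => (f c).bind (g c) := by
  rcases isEmpty_or_nonempty α with _ | ⟨⟨a⟩⟩
  · simp only [Subsingleton.elim (f _) none, Option.bind_none]
    exact measurable_const
  have hbind (c : γ) : (f c).bind (g c) = if (f c).isSome then g c ((f c).getD a) else none := by
    cases f c <;> rfl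
  have hgetD : Measurable fun o : Option α => o.getD a := measurable_of_comp_some measurable_id
  simp only [hbind]
  exact Measurable.ite (measurableSet_isSome hf) (hg.comp (measurable_id.prodMk (hgetD.comp hf)))
    measurable_const

end OptionMeasurability

section PairMeasurability

variable {V : Type*} {G : SimpleGraph V}

lemma measurable_wernerParam : Measurable wernerParam := by
  unfold wernerParam
  fun_prop

lemma measurable_wernerFidelity : Measurable wernerFidelity := by
  unfold wernerFidelity
  fun_prop

lemma NoiseModel.measurable_purifyProb (m : NoiseModel) :
    Measurable fun c : ℝ × ℝ => m.purifyProb c.1 c.2 := by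
  cases m <;> simp only [NoiseModel.purifyProb] <;> fun_prop

lemma NoiseModel.measurable_purifyFidelity (m : NoiseModel) :
    Measurable fun c : ℝ × ℝ => m.purifyFidelity c.1 c.2 := by
  cases m <;> simp only [NoiseModel.purifyFidelity, NoiseModel.purifyProb] <;> fun_prop

lemma NoiseModel.measurable_purify (m : NoiseModel) :
    Measurable fun c : (ℝ × Pair) × Pair => if c.1.1 < m.purifyProb c.1.2.2 c.2.2 then
      some (c.1.2.1, m.purifyFidelity c.1.2.2 c.2.2) else none := by
  have hfidelities : Measurable fun c : (ℝ × Pair) × Pair => (c.1.2.2, c.2.2) := by fun_prop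
  exact Measurable.ite
    (measurableSet_lt (by fun_prop) (m.measurable_purifyProb.comp hfidelities))
    (measurable_some.comp (Measurable.prodMk (by fun_prop)
      (m.measurable_purifyFidelity.comp hfidelities))) measurable_const

lemma Network.measurable_decay (net : Network G) : Measurable net.decay :=
  measurable_wernerFidelity.comp (measurable_wernerParam.mul_const _)

lemma Network.measurable_store (net : Network G) : Measurable net.store := by
  have hage : Measurable fun p : Pair => p.1 + 1 := by fun_prop
  have hdecay : Measurable fun p : Pair => net.decay p.2 := net.measurable_decay.comp measurable_snd
  exact Measurable.ite ((measurableSet_lt hage measurable_const).inter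
    (measurableSet_le measurable_const hdecay)) (measurable_some.comp (hage.prodMk hdecay))
    measurable_const

lemma Network.measurable_pool (net : Network G) (n : External G) (e : G.edgeSet)
    (r : net.PairName e) : Measurable fun s : net.Inventory => net.pool n s e r := by
  cases r with
  | inl i => exact (measurable_pi_apply i).comp (measurable_pi_apply e)
  | inr i => exact measurable_const

lemma Network.measurable_afterPurify (net : Network G) (n : External G) (a : net.Action)
    (e : G.edgeSet) (r : net.PairName e) :
    Measurable fun c : net.Inventory × net.Internal => net.afterPurify n c.1 a c.2 e r := by
  unfold Network.afterPurify
  cases a.purify e r with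
  | none =>
    split_ifs
    · exact measurable_const
    · exact (net.measurable_pool n e r).comp measurable_fst
  | some r' =>
    refine measurable_option_bind ((net.measurable_pool n e r).comp measurable_fst) ?_
    refine measurable_option_bind
      (f := fun c : (net.Inventory × net.Internal) × Pair => net.pool n c.1.1 e r')
      ((net.measurable_pool n e r').comp (measurable_fst.comp measurable_fst)) ?_
    have hround : Measurable fun c : ((net.Inventory × net.Internal) × Pair) × Pair =>
        (((c.1.1.2.1 e r : ℝ), c.1.2), c.2) := by
      fun_prop
    exact net.noise.measurable_purify.comp hround

lemma Network.measurable_next (net : Network G) (n : External G) (a : net.Action) :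
    Measurable fun c : net.Inventory × net.Internal => net.next n c.1 a c.2 := by
  refine measurable_pi_lambda _ fun e => measurable_pi_lambda _ fun i => ?_
  unfold Network.next
  cases a.keep e i with
  | none => exact measurable_const
  | some r =>
    exact measurable_option_bind
      (f := fun c : net.Inventory × net.Internal => net.afterPurify n c.1 a c.2 e r)
      (g := fun _ => net.store) (net.measurable_afterPurify n a e r)
      (net.measurable_store.comp measurable_snd)

end PairMeasurability

section Actions

variable {V : Type*} [Finite V] {G : SimpleGraph V}

instance Network.countable_activation (net : Network G) : Countable net.Activation := by
  have hpath (u v : V) : Countable (G.Path u v) :=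
    Function.Injective.countable (f := fun p : G.Path u v => (p : G.Walk u v).support)
      fun p q h => Subtype.ext (SimpleGraph.Walk.ext_support h)
  exact Function.Injective.countable
    (f := fun A : net.Activation =>
      (⟨A.flow, A.path, A.pick⟩ : Σ f : V × V, G.Path f.1 f.2 × ∀ e : G.edgeSet, net.PairName e))
    fun ⟨_, _, _⟩ ⟨_, _, _⟩ h => by cases h; rfl

instance Network.countable_action (net : Network G) : Countable net.Action :=
  Function.Injective.countable (f := fun a : net.Action => (a.activate, a.purify, a.keep))
    fun ⟨_, _, _⟩ ⟨_, _, _⟩ h => by cases h; rfl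

lemma Network.measurable_observe (net : Network G) (φ : net.Policy) :
    Measurable fun c : net.Inventory × net.SlotNoise => net.observe φ c.1 c.2 := by
  have hretained : Measurable fun c : net.Inventory × net.SlotNoise => net.retained c.2.1.1 :=
    (measurable_of_countable net.retained).comp (by fun_prop)
  exact hretained.prodMk (measurable_fst.prodMk
    (φ.measurable_act.comp (hretained.prodMk (Measurable.prodMk (by fun_prop) (by fun_prop)))))

-- The external multigraph and the action take countably many values, so that no joint
-- measurability in them is required.
lemma Network.measurable_comp_observe (net : Network G) (φ : net.Policy) {β : Type*}
    [MeasurableSpace β] {f : External G → net.Inventory → net.Action → net.Internal → β}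
    (hf : ∀ n a, Measurable fun c : net.Inventory × net.Internal => f n c.1 a c.2) :
    Measurable fun c : net.Inventory × net.SlotNoise =>
      f (net.observe φ c.1 c.2).1 (net.observe φ c.1 c.2).2.1 (net.observe φ c.1 c.2).2.2
        c.2.2 := by
  have : MeasurableSingletonClass net.Action := ⟨fun _ => trivial⟩
  have hjoint : Measurable fun d : (External G × net.Action) × (net.Inventory × net.Internal) =>
      f d.1.1 d.2.1 d.1.2 d.2.2 :=
    measurable_from_prod_countable_right fun d => hf d.1 d.2
  have hobserve := net.measurable_observe φ
  exact hjoint.comp ((hobserve.fst.prodMk hobserve.snd.snd).prodMk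
    (hobserve.snd.fst.prodMk measurable_snd.snd))

/-- The update rule of the driven system formed by the stored pairs: the inventory of the next
slot, from that of the current slot and its randomness. -/
noncomputable def Network.step (net : Network G) (φ : net.Policy)
    (c : net.Inventory × net.SlotNoise) : net.Inventory :=
  net.next (net.observe φ c.1 c.2).1 (net.observe φ c.1 c.2).2.1 (net.observe φ c.1 c.2).2.2 c.2.2

lemma Network.measurable_step (net : Network G) (φ : net.Policy) : Measurable (net.step φ) :=
  net.measurable_comp_observe φ net.measurable_next

end Actions

section Delivery

variable {V : Type*} [Fintype V] [DecidableEq V] {G : SimpleGraph V} [DecidableRel G.Adj]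

lemma Network.measurable_endFidelity (net : Network G) (n : External G) (a : net.Action)
    (A : net.Activation) :
    Measurable fun c : net.Inventory × net.Internal => net.endFidelity n c.1 a c.2 A := by
  refine measurable_wernerFidelity.comp (Finset.measurable_fun_prod _ fun e _ => ?_)
  split_ifs
  · have helim : Measurable fun o : Option Pair => o.elim 0 fun p => wernerParam p.2 :=
      measurable_of_comp_some (measurable_wernerParam.comp measurable_snd)
    exact helim.comp (net.measurable_afterPurify n a e _)
  · exact measurable_const

lemma Network.measurableSet_usable (net : Network G) (flow : V × V) (n : External G)
    (a : net.Action) :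
    MeasurableSet {c : net.Inventory × net.Internal | net.Usable flow n c.1 a c.2} := by
  have hpair (A : net.Activation) (e : G.edgeSet) :
      Measurable fun c : net.Inventory × net.Internal =>
        (net.afterPurify n c.1 a c.2 e (A.pick e)).isSome = true :=
    measurableSet_setOfPred.1 (measurableSet_isSome (net.measurable_afterPurify n a e _))
  have hswap (j : Fin net.budget) (v : V) :
      Measurable fun c : net.Inventory × net.Internal => c.2.2 j v = true :=
    measurableSet_setOfPred.1 (measurableSet_eq_fun (by fun_prop) measurable_const)
  have hfidelity (A : net.Activation) : Measurable fun c : net.Inventory × net.Internal =>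
      net.threshold ≤ net.endFidelity n c.1 a c.2 A :=
    measurableSet_setOfPred.1 (measurableSet_le measurable_const (net.measurable_endFidelity n a A))
  refine measurableSet_setOfPred.2 (.exists fun j => .exists fun A => .and measurable_const
    (.and measurable_const (.and (.forall fun e => .imp measurable_const
      (.and measurable_const (hpair A e))) (.and (.forall fun v => ?_) (hfidelity A)))))
  exact .imp measurable_const (.imp measurable_const (.imp measurable_const (hswap j v)))

open Classical in
/-- The delivery indicator of a slot, from the stored pairs and the randomness of the slot. -/
noncomputable def Network.deliver (net : Network G) (φ : net.Policy) (flow : V × V)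
    (c : net.Inventory × net.SlotNoise) : ℕ :=
  if net.Usable flow (net.observe φ c.1 c.2).1 (net.observe φ c.1 c.2).2.1
    (net.observe φ c.1 c.2).2.2 c.2.2 then 1 else 0

lemma Network.measurable_deliver (net : Network G) (φ : net.Policy) (flow : V × V) :
    Measurable (net.deliver φ flow) := by
  classical
  exact net.measurable_comp_observe φ
    (f := fun n s a w => if net.Usable flow n s a w then 1 else 0) fun n a =>
    Measurable.ite (net.measurableSet_usable flow n a) measurable_const measurable_const

end Delivery

section DrivenNetwork

variable {V : Type*} {G : SimpleGraph V} {net : Network G} {φ : net.Policy} {Ω : Type*}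
  {s₀ : Ω → net.Inventory} {ξ : ℕ → Ω → net.SlotNoise}

lemma Network.skewShift_step_iterate (t : ℕ) (ω : Ω) :
    (skewShift (net.step φ))^[t] (s₀ ω, fun r => ξ r ω) =
      (net.inventory φ s₀ ξ t ω, fun r => ξ (r + t) ω) := by
  induction t with
  | zero => rfl
  | succ t ih =>
    rw [Function.iterate_succ_apply', ih, skewShift]
    refine Prod.ext ?_ (funext fun r => ?_)
    · simp only [zero_add]
      rfl
    · exact congrArg (ξ · ω) (by omega)

variable [Fintype V] [DecidableEq V] [DecidableRel G.Adj] [MeasurableSpace Ω] {P : Measure Ω}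
  [IsProbabilityMeasure P]

lemma Network.IsDriven.isProbabilityMeasure_slotLaw (hξ : net.IsDriven P s₀ ξ) :
    IsProbabilityMeasure net.slotLaw := by
  rw [← hξ.law_noise 0]
  exact Measure.isProbabilityMeasure_map (hξ.measurable_noise 0).aemeasurable

lemma Network.IsDriven.measurePreserving_inputLaw (hξ : net.IsDriven P s₀ ξ) :
    MeasurePreserving (fun ω => (s₀ ω, fun r => ξ r ω)) P (inputLaw (P.map s₀) net.slotLaw) := by
  have hnoise : Measurable fun ω t => ξ t ω := measurable_pi_lambda _ hξ.measurable_noise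
  refine ⟨hξ.measurable_init.prodMk hnoise, ?_⟩
  rw [(indepFun_iff_map_prod_eq_prod_map_map hξ.measurable_init.aemeasurable
    hnoise.aemeasurable).1 hξ.indep_init,
    hξ.indep_noise.map_fun_eq_infinitePi_map hξ.measurable_noise]
  simp only [hξ.law_noise]

lemma Network.IsDriven.ergodic_skewShift_step (hξ : net.IsDriven P s₀ ξ)
    (hZ : IsStationaryErgodic P (net.state φ s₀ ξ)) :
    Ergodic (skewShift (net.step φ)) (inputLaw (P.map s₀) net.slotLaw) := by
  have hν := hξ.isProbabilityMeasure_slotLaw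
  have hμ : IsProbabilityMeasure (P.map s₀) :=
    Measure.isProbabilityMeasure_map hξ.measurable_init.aemeasurable
  have hq := hξ.measurePreserving_inputLaw
  have hT := measurable_skewShift (net.measurable_step φ)
  have hslot (t : ℕ) : Measurable fun ω => (net.inventory φ s₀ ξ t ω, ξ t ω) := by
    have h := (hT.iterate t).comp hq.measurable
    simp only [Function.comp_def, Network.skewShift_step_iterate] at h
    exact h.fst.prodMk (hξ.measurable_noise t)
  have hinventory : IsStationaryErgodic P (net.inventory φ s₀ ξ) :=
    isStationaryErgodic_map (fun t => (net.measurable_observe φ).comp (hslot t)) hZ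
      measurable_snd.fst
  refine ergodic_skewShift (net.measurable_step φ)
    ((isStationaryErgodic_comp_iff hq fun t => (hT.iterate t).fst).1 ?_)
  simpa only [Network.skewShift_step_iterate] using hinventory

theorem Network.IsDriven.isStationaryErgodic_delivery (hξ : net.IsDriven P s₀ ξ)
    (hZ : IsStationaryErgodic P (net.state φ s₀ ξ)) (flow : V × V) :
    (∀ t, Measurable (net.delivery φ flow s₀ ξ t)) ∧
      IsStationaryErgodic P (net.delivery φ flow s₀ ξ) := by
  have hq := hξ.measurePreserving_inputLaw
  have hT := hξ.ergodic_skewShift_step hZ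
  set observable : net.Inventory × (ℕ → net.SlotNoise) → ℕ :=
    fun p => net.deliver φ flow (p.1, p.2 0)
  have hobservable : Measurable observable :=
    (net.measurable_deliver φ flow).comp
      (measurable_fst.prodMk ((measurable_pi_apply 0).comp measurable_snd))
  have hdelivery : net.delivery φ flow s₀ ξ =
      fun t ω => observable ((skewShift (net.step φ))^[t] (s₀ ω, fun r => ξ r ω)) := by
    funext t ω
    simp only [observable, Network.skewShift_step_iterate, zero_add]
    rfl
  have hiterate (t : ℕ) := hobservable.comp (hT.measurable.iterate t)
  rw [hdelivery]
  exact ⟨fun t => (hiterate t).comp hq.measurable,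
    (isStationaryErgodic_comp_iff hq hiterate).2 (isStationaryErgodic_of_ergodic hT hobservable)⟩

end DrivenNetwork

end FidelityAge

open FidelityAge in
theorem theorem1_general {Ω : Type*} [MeasurableSpace Ω] (P : Measure Ω) [IsProbabilityMeasure P]
    (Y : ℕ → Ω → ℕ) (hYm : ∀ r, Measurable (Y r)) (hY : IsStationaryErgodic P Y)
    (Δ : ℝ) (hΔ : 0 < Δ) (t : ℕ) (hpos : 0 < P {ω | Y t ω = 1})
    (τ : Ω → ℝ≥0∞) (hτ : ∀ ω, τ ω = (interDelivery (fun r => Y r ω) t : ℝ≥0∞))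
    (m₁ m₂ : ℝ≥0∞) (hm₁ : m₁ = ∫⁻ ω, τ ω ∂P[|{ω | Y t ω = 1}])
    (hm₂ : m₂ = ∫⁻ ω, τ ω ^ 2 ∂P[|{ω | Y t ω = 1}]) (hfin₂ : m₂ < ∞) :
    (∀ᵐ ω ∂P, Tendsto
      (fun T : ℝ => T⁻¹ * ∫ u in (0 : ℝ)..T, fidelityAge Δ (fun r => Y r ω) u) atTop
      (𝓝 (Δ * (m₂.toReal / (2 * m₁.toReal))))) ∧
    (∀ p : ℝ, 0 < p → p ≤ 1 →
      (∀ k : ℕ, P[|{ω | Y t ω = 1}] {ω | τ ω = ((k + 1 : ℕ) : ℝ≥0∞)} =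
        ENNReal.ofReal ((1 - p) ^ k * p)) →
      ∀ᵐ ω ∂P, Tendsto
        (fun T : ℝ => T⁻¹ * ∫ u in (0 : ℝ)..T, fidelityAge Δ (fun r => Y r ω) u) atTop
        (𝓝 (Δ * ((2 - p) / (2 * p))))) := by
  have havg := ae_tendsto_average_fidelityAge hΔ hYm hY hpos.ne'
    (by simpa only [← hτ, ← hm₂] using hfin₂.ne)
  simp only [← hτ, ← hm₁, ← hm₂] at havg
  refine ⟨havg, fun p hp hp1 hgeom => ?_⟩
  have : IsProbabilityMeasure P[|{ω | Y t ω = 1}] := cond_isProbabilityMeasure hpos.ne'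
  have hτm : Measurable τ := by
    rw [funext hτ]
    exact (measurable_interDelivery t).comp (measurable_pi_lambda _ hYm)
  have hmean : m₁ = ENNReal.ofReal (1 / p) := by
    simpa only [pow_one, ← hm₁] using lintegral_pow_of_geometric (j := 1) hτm hp hp1 hgeom
      (by simpa only [pow_one] using hasSum_succ_mul_geometric hp hp1)
  have hsecond : m₂ = ENNReal.ofReal ((2 - p) / p ^ 2) :=
    hm₂.trans (lintegral_pow_of_geometric hτm hp hp1 hgeom (hasSum_succ_sq_mul_geometric hp hp1))
  have hlim : m₂.toReal / (2 * m₁.toReal) = (2 - p) / (2 * p) := by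
    have : 0 ≤ 2 - p := by linarith
    rw [hmean, hsecond, ENNReal.toReal_ofReal (by positivity),
      ENNReal.toReal_ofReal (by positivity)]
    field_simp
  rwa [hlim] at havg

open FidelityAge in
theorem theorem1 {V : Type*} [Fintype V] [DecidableEq V] {G : SimpleGraph V} [DecidableRel G.Adj]
    (net : Network G) (φ : net.Policy) (flow : V × V) (hflow : flow ∈ net.requests)
    {Ω : Type*} [MeasurableSpace Ω] (P : Measure Ω) [IsProbabilityMeasure P]
    (s₀ : Ω → net.Inventory) (ξ : ℕ → Ω → net.SlotNoise) (hξ : net.IsDriven P s₀ ξ)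
    (hZ : IsStationaryErgodic P (net.state φ s₀ ξ))
    (Y : ℕ → Ω → ℕ) (hY : Y = net.delivery φ flow s₀ ξ)
    (t : ℕ) (hpos : 0 < P {ω | Y t ω = 1}) (hlt : P {ω | Y t ω = 1} < 1)
    (τ : Ω → ℝ≥0∞) (hτ : ∀ ω, τ ω = (interDelivery (fun r => Y r ω) t : ℝ≥0∞))
    (m₁ m₂ : ℝ≥0∞) (hm₁ : m₁ = ∫⁻ ω, τ ω ∂P[|{ω | Y t ω = 1}])
    (hm₂ : m₂ = ∫⁻ ω, τ ω ^ 2 ∂P[|{ω | Y t ω = 1}])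
    (hfin₁ : m₁ < ∞) (hfin₂ : m₂ < ∞) :
    (∀ᵐ ω ∂P, Tendsto
      (fun T : ℝ => T⁻¹ * ∫ u in (0 : ℝ)..T, fidelityAge net.slot (fun r => Y r ω) u) atTop
      (𝓝 (net.slot * (m₂.toReal / (2 * m₁.toReal))))) ∧
    (∀ p : ℝ, 0 < p → p ≤ 1 →
      (∀ k : ℕ, P[|{ω | Y t ω = 1}] {ω | τ ω = ((k + 1 : ℕ) : ℝ≥0∞)} =
        ENNReal.ofReal ((1 - p) ^ k * p)) →
      ∀ᵐ ω ∂P, Tendsto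
        (fun T : ℝ => T⁻¹ * ∫ u in (0 : ℝ)..T, fidelityAge net.slot (fun r => Y r ω) u) atTop
        (𝓝 (net.slot * ((2 - p) / (2 * p))))) := by
  subst hY
  obtain ⟨hYm, hYe⟩ := hξ.isStationaryErgodic_delivery hZ flow
  exact theorem1_general P _ hYm hYe net.slot net.slot_pos t hpos τ hτ m₁ m₂ hm₁ hm₂ hfin₂
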